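/- An *infinite time Turing machine* has finitely many states, among them an initial state and a limit state, and one tape, infinite to the right only, over the alphabet $\{0,1\}$ with $0$ as blank. On input $x\in\mathbf N$ the tape initially holds a $0$ followed by $x$ many $1$'s and then $0$'s, the head is on the first square, and the machine is in the initial state. At successor ordinal times it follows the ordinary Turing machine rules: the instruction for the current state and scanned symbol, if there is one, gives the symbol to write, the direction (left or right; a left move on the first square leaves the head there) and the new state; if there is none, the machine halts. At a limit ordinal time, if it has not halted, it is in the limit state with the head on the first square, and a square holds $0$ if it has settled down to $0$, and $1$ otherwise. The output is the symbol on the first square. For an ordinal $\alpha$, a machine *decides $P\subseteq\mathbf N$ in $\alpha$ steps* if for every input $x$ the symbol on the first square at time $\alpha$ (or on halting, if it halts before) is $1$ if $x\in P$ and $0$ if $x\notin P$. It *decides $P$ in fewer than $\omega^2$ steps* if there is an ordinal $\alpha<\omega^2$ such that on every input $x$ it halts after at most $\alpha$ steps, with $1$ on the first square if $x\in P$ and $0$ if $x\notin P$. Let $\Sigma_0=\Pi_0$ be the class of recursive relations on $\mathbf N$; a relation is $\Sigma_{n+1}$ (resp. $\Pi_{n+1}$) if it arises from a $\Pi_n$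 (resp. $\Sigma_n$) relation by one existential (resp. universal) number quantifier; $\Delta_n=\Sigma_n\cap\Pi_n$. A predicate on $\mathbf N$ is *arithmetical* if it is in $\Sigma_n\cup\Pi_n$ for some $n$. Formulae of arithmetic are built from equations between terms in natural numbers, variables, $+$ and $\cdot$ by the connectives $\neg,\wedge,\vee,\to$ and the quantifiers $\forall,\exists$ over $\mathbf N$. 1. For every $n\ge 1$, every predicate in $\Delta_{n+1}$ is decided in $\omega\cdot n$ steps by some infinite time Turing machine. 2. Every arithmetical predicate is in $\Delta_{n+1}$ for some $n\ge1$, hence is decided in $\omega\cdot n$ steps by some infinite time Turing machine; and it is decided in fewer than $\omega^2$ steps by some infinite time Turing machine. 3. For every formula of arithmetic with exactly one free variable, the predicate on $\mathbf N$ that it expresses is decided in fewer than $\omega^2$ steps by some infinite time Turing machine. 4. Let $\varphi$ be a sentence of arithmetic and $x$ a variable that does not occur in $\varphi$. Then there is a formula that results from $\varphi$ by adding the term "$+\,x$" to one side of one occurrence of $=$; and every such formula $\psi$ has $x$ as its only free variable, $\psi(0)$ is true if and only if $\varphi$ is true, and some infinite time Turing machine decides the predicate $\psi(x)$ in fewer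 than $\omega^2$ steps, so that on input $0$ it halts after fewer than $\omega^2$ steps with output $1$ if $\varphi$ is true and $0$ if $\varphi$ is false. -/

import Mathlib

open scoped Ordinal

/-! ### Infinite time Turing machines -/

/-- The two directions in which the tape head can move. -/
inductive HeadMove where
  | left : HeadMove
  | right : HeadMove

/-- An infinite time Turing machine with one tape, unbounded to the right only, over the alphabet
`{0, 1}` (`false` is `0`, which is also the blank; `true` is `1`). It has finitely many states,
among them an initial state and a limit state. `instr q a` is the instruction
(symbol to write, direction, new state) that is applicable in state `q` when the symbol `a` is
scanned, or `none` if there is no such instruction. -/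
structure ITTM where
  State : Type
  finiteState : Finite State
  start : State
  limitState : State
  instr : State → Bool → Option (Bool × HeadMove × State)

namespace ITTM

/-- A configuration: current state, position of the head, and content of the tape; square `0` is
the first (leftmost) square. -/
structure Config (M : ITTM) where
  state : M.State
  head : ℕ
  tape : ℕ → Bool

/-- The tape on which the natural number `x` is inscribed: a `0`, then `x` many `1`s, then `0`s. -/
def inputTape (x : ℕ) : ℕ → Bool := fun i => decide (1 ≤ i ∧ i ≤ x)

/-- The new position of the head. The tape is bounded on the left: a move to the left from the
first square leaves the head there. -/
def moveHead : HeadMove → ℕ → ℕ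
  | HeadMove.left, i => i - 1
  | HeadMove.right, i => i + 1

/-- The initial configuration on input `x`. -/
def init (M : ITTM) (x : ℕ) : M.Config := ⟨M.start, 0, inputTape x⟩

/-- One step by the ordinary Turing machine rules; `none` if no instruction is applicable. -/
def step (M : ITTM) (c : M.Config) : Option M.Config :=
  match M.instr c.state (c.tape c.head) with
  | none => none
  | some (b, d, q) => some ⟨q, moveHead d c.head, Function.update c.tape c.head b⟩

open Classical in
/-- The configuration at a limit time `l`, given the run below `l` (`none` at the times that come
after the machine has halted). If the machine has halted at an earlier time, there is none.
Otherwise the machine is in the limit state, the head is on the first square, and a square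
carries `0` if it has settled down to `0` before `l`, and `1` otherwise (that is, if it has
settled down to `1`, or has alternated between `0` and `1` unboundedly often). -/
noncomputable def limitConfig (M : ITTM) (l : Ordinal.{0})
    (r : (b : Ordinal.{0}) → b < l → Option M.Config) : Option M.Config :=
  if ∃ (b : Ordinal.{0}) (hb : b < l), r b hb = none then none
  else some ⟨M.limitState, 0, fun i =>
    if ∃ b < l, ∀ (g : Ordinal.{0}) (hg : g < l), b ≤ g →
      ∃ c, r g hg = some c ∧ c.tape i = false then false else true⟩

/-- The run of `M` on input `x`: the configuration at ordinal time `t`, or `none` if the machine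
has halted at an earlier time. -/
noncomputable def run (M : ITTM) (x : ℕ) (t : Ordinal.{0}) : Option M.Config :=
  Ordinal.limitRecOn t (some (M.init x)) (fun _ r => r.bind M.step)
    (fun l _ r => M.limitConfig l r)

/-- On input `x` the machine halts after exactly `t` steps, in configuration `c`. -/
def HaltsAt (M : ITTM) (x : ℕ) (t : Ordinal.{0}) (c : M.Config) : Prop :=
  M.run x t = some c ∧ M.step c = none

/-- `c` is the configuration after at most `t` steps on input `x`: the one at time `t`, or the
final one if the machine has halted earlier. -/
def ConfigAfter (M : ITTM) (x : ℕ) (t : Ordinal.{0}) (c : M.Config) : Prop :=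
  M.run x t = some c ∨ ∃ s < t, M.HaltsAt x s c

/-- `M`, run for `t` steps as a `t`-time Turing machine, decides the predicate `P`: on every input
`x`, after `t` steps the first square of the tape (reserved for the output) holds `1` if `P x` and
`0` otherwise. -/
def DecidesIn (M : ITTM) (t : Ordinal.{0}) (P : ℕ → Prop) : Prop :=
  ∀ x, ∃ c, M.ConfigAfter x t c ∧ (c.tape 0 = true ↔ P x)

/-- On every input `x` the machine `M` halts after at most `t` steps, and then the first square of
the tape holds `1` if `P x` and `0` otherwise. -/
def DecidesHaltingWithin (M : ITTM) (t : Ordinal.{0}) (P : ℕ → Prop) : Prop :=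
  ∀ x, ∃ s ≤ t, ∃ c, M.HaltsAt x s c ∧ (c.tape 0 = true ↔ P x)

end ITTM

/-! ### The arithmetical hierarchy -/

/-- `ArithLevel true n R` says that the `k`-ary relation `R` on `ℕ` is `Σₙ`, and
`ArithLevel false n R` that it is `Πₙ`. Level `0` consists of the recursive relations; a `Σₙ₊₁`
relation is `∃ y, S (y, v)` with `S` in `Πₙ`, a `Πₙ₊₁` relation is `∀ y, S (y, v)` with `S` in
`Σₙ`. -/
def ArithLevel : Bool → ℕ → {k : ℕ} → (List.Vector ℕ k → Prop) → Prop
  | _, 0, _, R => ComputablePred R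
  | true, n + 1, k, R => ∃ S : List.Vector ℕ (k + 1) → Prop,
      ArithLevel false n S ∧ ∀ v, R v ↔ ∃ y, S (y ::ᵥ v)
  | false, n + 1, k, R => ∃ S : List.Vector ℕ (k + 1) → Prop,
      ArithLevel true n S ∧ ∀ v, R v ↔ ∀ y, S (y ::ᵥ v)

/-- The predicate `P` on `ℕ` is in `Σₙ`. -/
def InSigma (n : ℕ) (P : ℕ → Prop) : Prop :=
  ArithLevel true n (fun v : List.Vector ℕ 1 => P v.head)

/-- The predicate `P` on `ℕ` is in `Πₙ`. -/
def InPi (n : ℕ) (P : ℕ → Prop) : Prop :=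
  ArithLevel false n (fun v : List.Vector ℕ 1 => P v.head)

/-- The predicate `P` on `ℕ` is in `Δₙ = Σₙ ∩ Πₙ`. -/
def InDelta (n : ℕ) (P : ℕ → Prop) : Prop := InSigma n P ∧ InPi n P

/-- The predicate `P` on `ℕ` is in the arithmetical hierarchy. -/
def IsArithmetical (P : ℕ → Prop) : Prop := ∃ n, InSigma n P ∨ InPi n P

/-! ### First-order arithmetic -/

/-- Terms of arithmetic, built from natural numbers and variables by `+` and `·`. -/
inductive ArithTerm where
  | num : ℕ → ArithTerm
  | var : ℕ → ArithTerm
  | add : ArithTerm → ArithTerm → ArithTerm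
  | mul : ArithTerm → ArithTerm → ArithTerm

/-- Formulae of arithmetic; the only atomic formulae are equations. -/
inductive ArithFormula where
  | eq : ArithTerm → ArithTerm → ArithFormula
  | not : ArithFormula → ArithFormula
  | and : ArithFormula → ArithFormula → ArithFormula
  | or : ArithFormula → ArithFormula → ArithFormula
  | imp : ArithFormula → ArithFormula → ArithFormula
  | all : ℕ → ArithFormula → ArithFormula
  | ex : ℕ → ArithFormula → ArithFormula

namespace ArithTerm

/-- The value of a term under an assignment of natural numbers to the variables. -/
def eval (e : ℕ → ℕ) : ArithTerm → ℕ
  | num n => n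
  | var i => e i
  | add s t => s.eval e + t.eval e
  | mul s t => s.eval e * t.eval e

/-- The variables of a term. -/
def vars : ArithTerm → Finset ℕ
  | num _ => ∅
  | var i => {i}
  | add s t => s.vars ∪ t.vars
  | mul s t => s.vars ∪ t.vars

end ArithTerm

namespace ArithFormula

/-- Truth of a formula in the natural numbers under an assignment. -/
def Holds : ArithFormula → (ℕ → ℕ) → Prop
  | eq s t, e => s.eval e = t.eval e
  | not f, e => ¬ f.Holds e
  | and f g, e => f.Holds e ∧ g.Holds e
  | or f g, e => f.Holds e ∨ g.Holds e
  | imp f g, e => f.Holds e → g.Holds e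
  | all i f, e => ∀ a : ℕ, f.Holds (Function.update e i a)
  | ex i f, e => ∃ a : ℕ, f.Holds (Function.update e i a)

/-- The free variables of a formula. -/
def freeVars : ArithFormula → Finset ℕ
  | eq s t => s.vars ∪ t.vars
  | not f => f.freeVars
  | and f g => f.freeVars ∪ g.freeVars
  | or f g => f.freeVars ∪ g.freeVars
  | imp f g => f.freeVars ∪ g.freeVars
  | all i f => f.freeVars.erase i
  | ex i f => f.freeVars.erase i

/-- All variables that occur in a formula, free or bound (a quantified variable is counted even
if it does not occur in the scope of its quantifier). -/
def allVars : ArithFormula → Finset ℕ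
  | eq s t => s.vars ∪ t.vars
  | not f => f.allVars
  | and f g => f.allVars ∪ g.allVars
  | or f g => f.allVars ∪ g.allVars
  | imp f g => f.allVars ∪ g.allVars
  | all i f => insert i f.allVars
  | ex i f => insert i f.allVars

/-- A sentence is a formula without free variables. -/
def IsSentence (f : ArithFormula) : Prop := f.freeVars = ∅

/-- Truth of a sentence in the natural numbers (for a sentence the assignment is immaterial). -/
def IsTrue (f : ArithFormula) : Prop := ∀ e : ℕ → ℕ, f.Holds e

/-- The predicate expressed by a formula whose only free variable is `x` (the values of the other
variables are immaterial). -/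
def Pred (f : ArithFormula) (x : ℕ) (a : ℕ) : Prop := ∀ e : ℕ → ℕ, e x = a → f.Holds e

/-- `AddsVar x f g`: the formula `g` results from `f` by adding the term `+ x` to one side of one
occurrence of `=`. -/
inductive AddsVar (x : ℕ) : ArithFormula → ArithFormula → Prop
  | eqLeft (s t : ArithTerm) : AddsVar x (eq s t) (eq (ArithTerm.add s (ArithTerm.var x)) t)
  | eqRight (s t : ArithTerm) : AddsVar x (eq s t) (eq s (ArithTerm.add t (ArithTerm.var x)))
  | not {f g : ArithFormula} : AddsVar x f g → AddsVar x (not f) (not g)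
  | andLeft {f g : ArithFormula} (h : ArithFormula) : AddsVar x f g →
      AddsVar x (and f h) (and g h)
  | andRight {f g : ArithFormula} (h : ArithFormula) : AddsVar x f g →
      AddsVar x (and h f) (and h g)
  | orLeft {f g : ArithFormula} (h : ArithFormula) : AddsVar x f g →
      AddsVar x (or f h) (or g h)
  | orRight {f g : ArithFormula} (h : ArithFormula) : AddsVar x f g →
      AddsVar x (or h f) (or h g)
  | impLeft {f g : ArithFormula} (h : ArithFormula) : AddsVar x f g →
      AddsVar x (imp f h) (imp g h)
  | impRight {f g : ArithFormula} (h : ArithFormula) : AddsVar x f g →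
      AddsVar x (imp h f) (imp h g)
  | all {f g : ArithFormula} (i : ℕ) : AddsVar x f g → AddsVar x (all i f) (all i g)
  | ex {f g : ArithFormula} (i : ℕ) : AddsVar x f g → AddsVar x (ex i f) (ex i g)

end ArithFormula

/-!
An infinite time Turing machine can evaluate two number quantifiers in its first `ω` steps and one
more in every further `ω` steps, so it decides `Πₙ₊₁` predicates in `ω · n` steps.

*The first stage.* For a `Π₂` relation there is a primitive recursive function `e` such that the
relation holds of `x` and `m` if and only if `m = e x s` for infinitely many `s` (`exists_hits`): to
verify `∀ y ∃ z` means to be successful infinitely often. A machine that writes a `1` at index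
`e x s` of a table at stage `s` and erases it at stage `s + 1` finds, by the limit rule, exactly the
`m` that satisfy the relation marked in the table at time `ω` (`Frag.first_stage`).

*The later stages.* From a table `T` the machine obtains, in `ω` steps and in place, the table
`nor T` whose entry `m` is `∀ y, ¬ T ⟨m, y⟩`: at stage `s = ⟨m, y⟩` it replaces entry `s`, which has
not been touched before since earlier stages concern smaller indices, by `1`, and if it was `1`
before it sets entry `m ≤ s` to `0` for good (`Frag.later_stage`). Iterating `nor` gives the
alternating quantifiers of a `Πₙ` relation (`exists_nor_hits`). A row of flags on the first square
counts the limits that have been passed, so that the machine can also halt in time (`exists_ittm`).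

*Programming.* The machines are built with several tracks, which are interleaved on the single
tape; between two steps of the machine with tracks, each square has either its old or its new
content (`TrackNext.Path.toITTM`), so the behaviour in the limit can be read off the tracks. A
register is a track, and its content is the position of the first `0` on it. What stands behind this
`0` is irrelevant, and therefore a register can be used after a limit as soon as its first square
has been reset. Loop programs over the registers compute all primitive recursive functions
(`Nat.Primrec'.realizable`).

For the formulae of arithmetic it remains to see that they define arithmetical predicates
(`ArithFormula.isArithmetical_pred`), and that adding a summand of value `0` does not change a truth
value (`ArithFormula.AddsVar.holds_iff`).
-/

/-! ### Runs through one limit stage -/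

namespace ITTM

variable {M : ITTM}

theorem run_zero (M : ITTM) (x : ℕ) : M.run x 0 = some (M.init x) := by
  simp [run]

theorem run_add_one (M : ITTM) (x : ℕ) (t : Ordinal.{0}) :
    M.run x (t + 1) = (M.run x t).bind M.step := by
  simp [run]

theorem run_limit (M : ITTM) (x : ℕ) {t : Ordinal.{0}} (ht : Order.IsSuccLimit t) :
    M.run x t = M.limitConfig t fun b _ => M.run x b := by
  simp [run, ht]

theorem run_ne_none_of_le (M : ITTM) (x : ℕ) (t : Ordinal.{0}) :
    M.run x t ≠ none → ∀ b ≤ t, M.run x b ≠ none := by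
  induction t using Ordinal.limitRecOn with
  | zero => intro h b hb; rwa [nonpos_iff_eq_zero.1 hb]
  | add_one t ih =>
    intro h b hb
    rcases hb.eq_or_lt with rfl | hb
    · exact h
    · refine ih (fun h0 => h ?_) b (Order.lt_add_one_iff.1 hb)
      rw [run_add_one, h0]; rfl
  | limit t ht _ =>
    intro h b hb
    rcases hb.eq_or_lt with rfl | hb
    · exact h
    · intro h0
      apply h
      rw [run_limit M x ht, limitConfig, if_pos ⟨b, hb, h0⟩]

/-- `M.Path q a b`: the machine gets from `a` to `b` in finitely many, but at least one, steps, and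
on the way (ends included) the content `v` of each square `i` satisfies `q i v`. -/
def Path (M : ITTM) (q : ℕ → Bool → Prop) : M.Config → M.Config → Prop :=
  Relation.TransGen fun a b =>
    (∀ i, q i (a.tape i)) ∧ M.step a = some b ∧ ∀ i, q i (b.tape i)

theorem Path.run {q : ℕ → Bool → Prop} {a b : M.Config} (h : M.Path q a b) {x : ℕ}
    {t : Ordinal.{0}} (ha : M.run x t = some a) :
    ∃ n : ℕ, 0 < n ∧ M.run x (t + n) = some b ∧
      ∀ k ≤ n, ∃ d, M.run x (t + (k : ℕ)) = some d ∧ ∀ i, q i (d.tape i) := by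
  induction h with
  | @single b h =>
    have h1 : M.run x (t + 1) = some b := by rw [run_add_one, ha]; exact h.2.1
    refine ⟨1, one_pos, by simpa using h1, fun k hk => ?_⟩
    obtain rfl | rfl : k = 0 ∨ k = 1 := by omega
    · exact ⟨_, by simpa using ha, h.1⟩
    · exact ⟨_, by simpa using h1, h.2.2⟩
  | @tail b c _ h ih =>
    obtain ⟨n, hn, hb, hq⟩ := ih
    have h1 : M.run x (t + (n + 1 : ℕ)) = some c := by
      rw [Nat.cast_add, Nat.cast_one, ← add_assoc, run_add_one, hb]; exact h.2.1
    refine ⟨n + 1, by omega, h1, fun k hk => ?_⟩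
    obtain hk | rfl : k ≤ n ∨ k = n + 1 := by omega
    · exact hq k hk
    · exact ⟨_, h1, h.2.2⟩

/-- If the machine visits `C 0, C 1, …` after time `t` and its squares stay within `q s` between
`C s` and `C (s + 1)`, then at time `t + ω` it is in the limit state, the squares which the `q s`
force to be `0` for all large `s` are `0`, and those that are `1` in infinitely many `C s` are
`1`. -/
theorem run_add_omega0 {x : ℕ} {t : Ordinal.{0}} {C : ℕ → M.Config} {q : ℕ → ℕ → Bool → Prop}
    (h0 : M.run x t = some (C 0)) (hC : ∀ s, M.Path (q s) (C s) (C (s + 1))) :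
    ∃ L : ℕ → Bool, M.run x (t + ω) = some ⟨M.limitState, 0, L⟩ ∧
      (∀ i, (∃ s₀, ∀ s ≥ s₀, ∀ v, q s i v → v = false) → L i = false) ∧
      ∀ i, (∀ s₀, ∃ s ≥ s₀, (C s).tape i = true) → L i = true := by
  have hstep : ∀ (s : ℕ) (m : ℕ), M.run x (t + m) = some (C s) →
      ∃ n : ℕ, 0 < n ∧ M.run x (t + (m + n : ℕ)) = some (C (s + 1)) ∧
        ∀ k ≤ n, ∃ d, M.run x (t + (m + k : ℕ)) = some d ∧ ∀ i, q s i (d.tape i) := by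
    intro s m hm
    obtain ⟨n, hn, hb, hq⟩ := (hC s).run hm
    refine ⟨n, hn, by rwa [Nat.cast_add, ← add_assoc], fun k hk => ?_⟩
    obtain ⟨d, hd, hd'⟩ := hq k hk
    exact ⟨d, by rwa [Nat.cast_add, ← add_assoc], hd'⟩
  choose! n hn hrun hq using hstep
  obtain ⟨τ, hτ0, hτs⟩ : ∃ τ : ℕ → ℕ, τ 0 = 0 ∧ ∀ s, τ (s + 1) = τ s + n s (τ s) :=
    ⟨fun s => Nat.rec 0 (fun s m => m + n s m) s, rfl, fun _ => rfl⟩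
  have hτ : ∀ s : ℕ, M.run x (t + τ s) = some (C s) := by
    intro s
    induction s with
    | zero => simpa [hτ0] using h0
    | succ s ih => rw [hτs]; exact hrun s (τ s) ih
  have hlt : ∀ s, τ s < τ (s + 1) := fun s => by
    rw [hτs]; exact Nat.lt_add_of_pos_right (hn s _ (hτ s))
  have hmono : StrictMono τ := strictMono_nat_of_lt_succ hlt
  have hmid : ∀ s₀ j k, τ s₀ ≤ k → k < τ (s₀ + j) →
      ∃ s ≥ s₀, ∃ d, M.run x (t + (k : ℕ)) = some d ∧ ∀ i, q s i (d.tape i) := by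
    intro s₀ j
    induction j with
    | zero => intro k h1 h2; simp at h2; omega
    | succ j ih =>
      intro k h1 h2
      by_cases h3 : k < τ (s₀ + j)
      · exact ih k h1 h3
      · have h4 : τ (s₀ + (j + 1)) = τ (s₀ + j) + n (s₀ + j) (τ (s₀ + j)) := hτs _
        obtain ⟨d, hd, hd'⟩ := hq (s₀ + j) _ (hτ (s₀ + j)) (k - τ (s₀ + j)) (by omega)
        rw [show τ (s₀ + j) + (k - τ (s₀ + j)) = k by omega] at hd
        exact ⟨s₀ + j, by simp, d, hd, hd'⟩
  have hall : ∀ s₀ k, τ s₀ ≤ k →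
      ∃ s ≥ s₀, ∃ d, M.run x (t + (k : ℕ)) = some d ∧ ∀ i, q s i (d.tape i) := by
    intro s₀ k hk
    refine hmid s₀ (k + 1) k hk ?_
    exact lt_of_lt_of_le (Nat.lt_succ_self k) ((hmono.le_apply).trans (hmono.monotone (by omega)))
  have hlim : Order.IsSuccLimit (t + ω) := Ordinal.isSuccLimit_add _ Ordinal.isSuccLimit_omega0
  have hlt_of : ∀ k : ℕ, t + k < t + ω := fun k => by gcongr; exact Ordinal.natCast_lt_omega0 k
  have hge : ∀ g < t + ω, ∃ k : ℕ, g ≤ t + k := by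
    intro g hg
    rw [Ordinal.lt_add_iff_of_isSuccLimit Ordinal.isSuccLimit_omega0] at hg
    obtain ⟨d, hd, hg⟩ := hg
    obtain ⟨k, rfl⟩ := Ordinal.lt_omega0.1 hd
    exact ⟨k, hg.le⟩
  have hex : ∀ g, t ≤ g → g < t + ω → ∃ k : ℕ, g = t + k := by
    intro g h1 h2
    have h3 : g - t < ω := by
      rwa [← Ordinal.add_sub_cancel_of_le h1, add_lt_add_iff_left] at h2
    obtain ⟨k, hk⟩ := Ordinal.lt_omega0.1 h3
    exact ⟨k, by rw [← hk, Ordinal.add_sub_cancel_of_le h1]⟩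
  have hnone : ¬ ∃ (b : Ordinal.{0}) (_ : b < t + ω), M.run x b = none := by
    rintro ⟨b, hb, hb0⟩
    obtain ⟨k, hk⟩ := hge b hb
    obtain ⟨_, _, d, hd, _⟩ := hall 0 k (by simp [hτ0])
    exact M.run_ne_none_of_le x (t + k) (by simp [hd]) b hk hb0
  refine ⟨_, by rw [run_limit M x hlim, limitConfig, if_neg hnone], ?_, ?_⟩
  · rintro i ⟨s₀, hs⟩
    refine if_pos ⟨t + τ s₀, hlt_of _, fun g hg hle => ?_⟩
    obtain ⟨k, rfl⟩ := hex g (le_self_add.trans hle) hg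
    have hk : τ s₀ ≤ k := by simpa using hle
    obtain ⟨s, h1, d, hd, hd'⟩ := hall s₀ k hk
    exact ⟨d, hd, hs s h1 _ (hd' i)⟩
  · intro i hi
    refine if_neg ?_
    rintro ⟨b, hb, hb'⟩
    obtain ⟨k, hk⟩ := hge b hb
    obtain ⟨s, hs, htrue⟩ := hi k
    obtain ⟨c, hc, hc'⟩ := hb' (t + τ s) (hlt_of _)
      (hk.trans (by gcongr; exact hs.trans hmono.le_apply))
    rw [hτ s] at hc
    cases hc
    rw [htrue] at hc'
    cases hc'

end ITTM

/-! ### Machines with several tracks -/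

/-- A configuration of a Turing machine whose squares carry one bit for each track `i : ι`. -/
structure TrackConfig (S ι : Type) where
  state : S
  head : ℕ
  tape : ℕ → ι → Bool

/-- The transition function of a machine with tracks: for a state and a scanned symbol, the symbol
to write, the direction and the new state; `none` if there is no instruction. -/
abbrev TrackNext (S ι : Type) := S → (ι → Bool) → Option ((ι → Bool) × HeadMove × S)

namespace TrackNext

variable {S ι : Type}

/-- One step of a machine with tracks. -/
def step (next : TrackNext S ι) (c : TrackConfig S ι) : Option (TrackConfig S ι) :=
  (next c.state (c.tape c.head)).map fun p =>
    ⟨p.2.2, ITTM.moveHead p.2.1 c.head, Function.update c.tape c.head p.1⟩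

/-- `next.Path q a b`: the machine gets from `a` to `b` in finitely many, but at least one, steps,
and on the way (ends included) the bit `v` in square `b` on track `i` satisfies `q b i v`. -/
def Path (next : TrackNext S ι) (q : ℕ → ι → Bool → Prop) :
    TrackConfig S ι → TrackConfig S ι → Prop :=
  Relation.TransGen fun a b =>
    (∀ n i, q n i (a.tape n i)) ∧ next.step a = some b ∧ ∀ n i, q n i (b.tape n i)

theorem Path.mono {next : TrackNext S ι} {q q' : ℕ → ι → Bool → Prop} {a b : TrackConfig S ι}
    (h : next.Path q a b) (hq : ∀ n i v, q n i v → q' n i v) : next.Path q' a b :=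
  Relation.TransGen.mono (fun _ _ h => ⟨fun n i => hq _ _ _ (h.1 n i), h.2.1,
    fun n i => hq _ _ _ (h.2.2 n i)⟩) _ _ h

end TrackNext

/-! ### Tracks as interleaved squares -/

namespace TrackNext

/-- The states of the machine over `{0, 1}` that executes a machine with `w` tracks: square `n` of
the latter is the block of the squares `n * w, …, n * w + w - 1`. One step consists in reading a
block from left to right, writing it from right to left, and moving on by one block.
In `read q k a` the bits `0, …, k - 1` have been read into `a`; in `write a d q k` the bits
`k, …, 0` are still to be written; in `move d q k` there are `k` more moves to make. -/
inductive BlockState (S ι : Type) (w : ℕ) where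
  | read (q : S) (k : Fin (w + 1)) (a : ι → Bool)
  | write (a : ι → Bool) (d : HeadMove) (q : S) (k : Fin w)
  | move (d : HeadMove) (q : S) (k : Fin w)

instance : Finite HeadMove :=
  Finite.of_injective (fun d : HeadMove => match d with | .left => false | .right => true) (by
    intro a b; cases a <;> cases b <;> simp)

instance {S ι : Type} {w : ℕ} [Finite S] [Finite ι] : Finite (BlockState S ι w) := by
  let f : BlockState S ι w → (S × Fin (w + 1) × (ι → Bool)) ⊕
      ((ι → Bool) × HeadMove × S × Fin w) ⊕ (HeadMove × S × Fin w) := fun s =>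
    match s with
    | .read q k a => .inl (q, k, a)
    | .write a d q k => .inr (.inl (a, d, q, k))
    | .move d q k => .inr (.inr (d, q, k))
  refine Finite.of_injective f ?_
  intro a b h
  cases a <;> cases b <;> simp_all [f]

variable {S ι : Type} {w : ℕ}

/-- The state in which the machine starts to execute a step in state `q`. -/
def BlockState.ready (w : ℕ) (q : S) : BlockState S ι w := .read q 0 fun _ => false

/-- The state with `k` more moves to make before the next step. -/
def BlockState.moves (d : HeadMove) (q : S) (k : Fin w) : BlockState S ι w :=
  if k.val = 0 then .ready w q else .move d q k

variable [hw : NeZero w]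

/-- The tape over `{0, 1}` that represents a tape with tracks. -/
def flat (enc : ι ≃ Fin w) (T : ℕ → ι → Bool) (i : ℕ) : Bool :=
  T (i / w) (enc.symm ⟨i % w, Nat.mod_lt _ (NeZero.pos w)⟩)

/-- The tape with tracks that a tape over `{0, 1}` represents. -/
def unflat (enc : ι ≃ Fin w) (t : ℕ → Bool) (n : ℕ) (i : ι) : Bool := t (n * w + enc i)

theorem flat_unflat (enc : ι ≃ Fin w) (t : ℕ → Bool) : flat enc (unflat enc t) = t := by
  funext i
  simp [flat, unflat, Nat.div_add_mod']

theorem flat_add (enc : ι ≃ Fin w) (T : ℕ → ι → Bool) (n k : ℕ) (hk : k < w) :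
    flat enc T (n * w + k) = T n (enc.symm ⟨k, hk⟩) := by
  have h1 : (n * w + k) / w = n := by
    rw [mul_comm, Nat.mul_add_div (NeZero.pos w), Nat.div_eq_of_lt hk, add_zero]
  have h2 : (n * w + k) % w = k := by
    rw [mul_comm, Nat.mul_add_mod, Nat.mod_eq_of_lt hk]
  simp [flat, h1, h2]

theorem flat_of_ne (enc : ι ≃ Fin w) (T : ℕ → ι → Bool) (n : ℕ) (a : ι → Bool) (i : ℕ)
    (h : i < n * w ∨ n * w + w ≤ i) : flat enc (Function.update T n a) i = flat enc T i := by
  have : i / w ≠ n := by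
    rintro rfl
    have h1 := Nat.div_add_mod' i w
    have h2 := Nat.mod_lt i (NeZero.pos w)
    omega
  simp [flat, Function.update_of_ne this]

/-- The condition on the squares of a tape over `{0, 1}` that expresses `q`. -/
def flatCond (enc : ι ≃ Fin w) (q : ℕ → ι → Bool → Prop) (i : ℕ) (v : Bool) : Prop :=
  q (i / w) (enc.symm ⟨i % w, Nat.mod_lt _ (NeZero.pos w)⟩) v

variable [Finite S] [Finite ι]

open Classical in
/-- The machine over `{0, 1}` that executes a machine with tracks. -/
noncomputable def toITTM (next : TrackNext S ι) (enc : ι ≃ Fin w) (start limit : S) : ITTM where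
  State := BlockState S ι w
  finiteState := inferInstance
  start := .ready w start
  limitState := .ready w limit
  instr s b :=
    match s with
    | .read q k a =>
      if h : k.val < w then
        some (b, .right, .read q ⟨k + 1, by omega⟩ (Function.update a (enc.symm ⟨k, h⟩) b))
      else (next q a).map fun p =>
        (b, .left, .write p.1 p.2.1 p.2.2 ⟨w - 1, Nat.sub_one_lt hw.ne⟩)
    | .write a d q k =>
      if k.val = 0 then some (a (enc.symm k), d, .moves d q ⟨w - 1, Nat.sub_one_lt hw.ne⟩)
      else some (a (enc.symm k), .left, .write a d q ⟨k - 1, by omega⟩)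
    | .move d q k => some (b, d, .moves d q ⟨k - 1, by omega⟩)

/-- The configuration that represents a configuration with tracks. -/
def _root_.TrackConfig.embed (c : TrackConfig S ι) (enc : ι ≃ Fin w) (next : TrackNext S ι)
    (start limit : S) :
    (next.toITTM enc start limit).Config :=
  ⟨.ready w c.state, c.head * w, flat enc c.tape⟩

variable {next : TrackNext S ι} {enc : ι ≃ Fin w} {start limit : S}

/-- The step relation of the machine over `{0, 1}`, restricted to tapes that satisfy `C`. -/
abbrev blockStep (next : TrackNext S ι) (enc : ι ≃ Fin w) (start limit : S)
    (C : ℕ → Bool → Prop) (a b : (next.toITTM enc start limit).Config) : Prop :=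
  (∀ i, C i (a.tape i)) ∧ (next.toITTM enc start limit).step a = some b ∧ ∀ i, C i (b.tape i)

open Classical in
/-- The bits of a block are read one after the other; `k` of them are known after `k` steps. -/
theorem reads (q : S) (n : ℕ) (T : ℕ → ι → Bool) {C : ℕ → Bool → Prop}
    (hC : ∀ i, C i (flat enc T i)) (k : ℕ) (hk : k ≤ w) :
    ∃ a : ι → Bool, (∀ j (hj : j < w), j < k → a (enc.symm ⟨j, hj⟩) = T n (enc.symm ⟨j, hj⟩)) ∧
      Relation.ReflTransGen (blockStep next enc start limit C)
        ⟨BlockState.ready w q, n * w, flat enc T⟩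
        ⟨BlockState.read q ⟨k, by omega⟩ a, n * w + k, flat enc T⟩ := by
  induction k with
  | zero => exact ⟨fun _ => false, by simp, .refl⟩
  | succ k ih =>
    obtain ⟨a, ha, hp⟩ := ih (by omega)
    refine ⟨Function.update a (enc.symm ⟨k, hk⟩) (T n (enc.symm ⟨k, hk⟩)), ?_,
      hp.tail ⟨hC, ?_, hC⟩⟩
    · intro j hj hjk
      by_cases h : j = k
      · subst h; simp
      · rw [Function.update_of_ne (by simpa using h)]
        exact ha j hj (by omega)
    · have hk' : k < w := hk
      simp [ITTM.step, toITTM, hk', flat_add, ITTM.moveHead, add_assoc]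

theorem reads_all (c : TrackConfig S ι) {C : ℕ → Bool → Prop}
    (hC : ∀ i, C i (flat enc c.tape i)) :
    Relation.ReflTransGen (blockStep next enc start limit C) (c.embed enc next start limit)
      ⟨BlockState.read c.state ⟨w, by omega⟩ (c.tape c.head), c.head * w + w,
        flat enc c.tape⟩ := by
  obtain ⟨a, ha, hp⟩ := reads (next := next) (start := start) (limit := limit) c.state c.head
    c.tape hC w le_rfl
  have : a = c.tape c.head := by
    funext i
    simpa using ha (enc i) (enc i).2 (enc i).2
  rwa [this] at hp

theorem step_read_eq_none (c : TrackConfig S ι) (hc : next.step c = none) (t : ℕ → Bool) (h : ℕ) :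
    (next.toITTM enc start limit).step
      ⟨BlockState.read c.state ⟨w, by omega⟩ (c.tape c.head), h, t⟩ = none := by
  simp only [step, Option.map_eq_none_iff] at hc
  simp [ITTM.step, toITTM, hc]

/-- A block is written from right to left. On the way each square holds its old or its new content,
so that every condition met by the tape before and after is met throughout. -/
theorem writes (q : S) (d : HeadMove) (n : ℕ) (T : ℕ → ι → Bool) (a : ι → Bool)
    {C : ℕ → Bool → Prop} (hC : ∀ i, C i (flat enc T i))
    (hC' : ∀ i, C i (flat enc (Function.update T n a) i)) (k : ℕ) (hk : k < w) :
    Relation.TransGen (blockStep next enc start limit C)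
      ⟨BlockState.write a d q ⟨k, hk⟩, n * w + k, fun i => if n * w + k < i then
        flat enc (Function.update T n a) i else flat enc T i⟩
      ⟨BlockState.moves d q ⟨w - 1, Nat.sub_one_lt hw.ne⟩, ITTM.moveHead d (n * w),
        flat enc (Function.update T n a)⟩ := by
  have hmix : ∀ k i, C i (if n * w + k < i then flat enc (Function.update T n a) i
      else flat enc T i) := fun k i => by split_ifs <;> simp [hC, hC']
  have key : flat enc (Function.update T n a) (n * w + k) = a (enc.symm ⟨k, hk⟩) := by
    simp [flat_add, hk]
  induction k with
  | zero =>
    refine .single ⟨hmix 0, ?_, hC'⟩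
    simp only [ITTM.step, toITTM, add_zero, if_true, Option.some.injEq, ITTM.Config.mk.injEq,
      true_and]
    funext i
    rcases lt_trichotomy i (n * w) with h | rfl | h
    · rw [Function.update_of_ne h.ne, if_neg (by omega), flat_of_ne _ _ _ _ _ (.inl h)]
    · rw [Function.update_self, ← key, add_zero]
    · rw [Function.update_of_ne h.ne', if_pos h]
  | succ k ih =>
    refine .head ⟨hmix _, ?_, hmix k⟩ (ih (by omega) (by simp [flat_add, show k < w by omega]))
    simp only [ITTM.step, toITTM, ITTM.moveHead, Nat.succ_ne_zero, if_false, Option.some.injEq,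
      ITTM.Config.mk.injEq, Nat.add_sub_cancel, true_and, ← add_assoc]
    funext i
    rcases lt_trichotomy i (n * w + k + 1) with h | rfl | h
    · rw [Function.update_of_ne h.ne, if_neg (by omega), if_neg (by omega)]
    · rw [Function.update_self, ← key, if_pos (by omega), add_assoc]
    · rw [Function.update_of_ne h.ne', if_pos h, if_pos (by omega)]

/-- The machine over `{0, 1}` makes `k` further moves in the same direction without writing. -/
theorem moves_all (q : S) (d : HeadMove) (h : ℕ) (t : ℕ → Bool)
    {C : ℕ → Bool → Prop} (hC : ∀ i, C i (t i)) (k : ℕ) (hk : k < w) :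
    Relation.ReflTransGen (blockStep next enc start limit C)
      ⟨BlockState.moves d q ⟨k, hk⟩, h, t⟩
      ⟨BlockState.ready w q, (ITTM.moveHead d)^[k] h, t⟩ := by
  induction k generalizing h with
  | zero => simpa [BlockState.moves] using Relation.ReflTransGen.refl
  | succ k ih =>
    refine .head ⟨hC, ?_, hC⟩ (ih (ITTM.moveHead d h) (by omega))
    simp [ITTM.step, toITTM, BlockState.moves]

/-- One move of the head by a block is `w` moves by a square, also at the left end of the tape. -/
theorem iterate_moveHead (d : HeadMove) (n : ℕ) :
    (ITTM.moveHead d)^[w - 1] (ITTM.moveHead d (n * w)) = ITTM.moveHead d n * w := by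
  rw [← Function.iterate_succ_apply, Nat.succ_eq_add_one, Nat.sub_add_cancel (NeZero.pos w)]
  cases d with
  | left =>
    have : ∀ k h : ℕ, (ITTM.moveHead .left)^[k] h = h - k := by
      intro k
      induction k with
      | zero => simp
      | succ k ih => intro h; rw [Function.iterate_succ_apply, ih]; simp [ITTM.moveHead]; omega
    rw [this]
    simp [ITTM.moveHead, Nat.sub_mul]
  | right =>
    have : ∀ k h : ℕ, (ITTM.moveHead .right)^[k] h = h + k := by
      intro k
      induction k with
      | zero => simp
      | succ k ih => intro h; rw [Function.iterate_succ_apply, ih]; simp [ITTM.moveHead]; omega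
    rw [this]
    simp [ITTM.moveHead, Nat.add_mul]

/-- A run with tracks is a run over `{0, 1}`, and the conditions on the bits carry over: while a
block is rewritten, each of its squares has either its old or its new content. -/
theorem Path.toITTM {q : ℕ → ι → Bool → Prop} {a b : TrackConfig S ι} (h : next.Path q a b)
    (enc : ι ≃ Fin w) (start limit : S) :
    (next.toITTM enc start limit).Path (flatCond enc q) (a.embed enc next start limit)
      (b.embed enc next start limit) := by
  refine Relation.TransGen.lift' (fun c => c.embed enc next start limit) ?_ _ _ h
  rintro a b ⟨ha, hab, hb⟩
  have ha' : ∀ i, flatCond enc q i (flat enc a.tape i) := fun i => ha _ _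
  have hb' : ∀ i, flatCond enc q i (flat enc b.tape i) := fun i => hb _ _
  simp only [step, Option.map_eq_some_iff] at hab
  obtain ⟨⟨γ, d, q'⟩, hnext, rfl⟩ := hab
  have h1 := reads_all (next := next) (start := start) (limit := limit) a ha'
  have hk : w - 1 < w := Nat.sub_one_lt hw.ne
  have h2 := writes (next := next) (start := start) (limit := limit) q' d a.head a.tape γ ha' hb'
    (w - 1) hk
  have h3 := moves_all (next := next) (enc := enc) (start := start) (limit := limit) q' d
    (ITTM.moveHead d (a.head * w)) _ hb' (w - 1) hk
  rw [iterate_moveHead] at h3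
  refine Relation.TransGen.trans_right h1 (.head ?_ (h2.trans_left h3))
  have htape : (fun i => if a.head * w + (w - 1) < i then
      flat enc (Function.update a.tape a.head γ) i else flat enc a.tape i) = flat enc a.tape := by
    funext i
    split_ifs with h
    · exact flat_of_ne _ _ _ _ _ (.inr (by omega))
    · rfl
  rw [htape]
  refine ⟨ha', ?_, ha'⟩
  have hsub : a.head * w + w - 1 = a.head * w + (w - 1) := by omega
  simp [ITTM.step, TrackNext.toITTM, hnext, ITTM.moveHead, hsub]

end TrackNext

/-! ### Program fragments -/

namespace TrackNext

theorem Path.map {S S' ι : Type} {next : TrackNext S ι} {next' : TrackNext S' ι}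
    {q : ℕ → ι → Bool → Prop} {a b : TrackConfig S ι} (h : next.Path q a b) (f : S → S')
    (hf : ∀ s a p, next s a = some p → next' (f s) a = some (p.1, p.2.1, f p.2.2)) :
    next'.Path q ⟨f a.state, a.head, a.tape⟩ ⟨f b.state, b.head, b.tape⟩ := by
  refine Relation.TransGen.lift
    (fun c : TrackConfig S ι => (⟨f c.state, c.head, c.tape⟩ : TrackConfig S' ι)) ?_ _ _ h
  rintro a b ⟨ha, hab, hb⟩
  refine ⟨ha, ?_, hb⟩
  simp only [step, Option.map_eq_some_iff] at hab
  obtain ⟨p, hp, rfl⟩ := hab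
  simp [step, hf _ _ _ hp]

theorem Path.good_right {S ι : Type} {next : TrackNext S ι} {q : ℕ → ι → Bool → Prop}
    {a b : TrackConfig S ι} (h : next.Path q a b) : ∀ n i, q n i (b.tape n i) := by
  cases h with
  | single h => exact h.2.2
  | tail _ h => exact h.2.2

/-- Paths of one step. -/
theorem Path.of_next {S ι : Type} {next : TrackNext S ι} {q : ℕ → ι → Bool → Prop} {s s' : S}
    {h : ℕ} {T : ℕ → ι → Bool} {a : ι → Bool} {d : HeadMove}
    (hn : next s (T h) = some (a, d, s')) (hT : ∀ n i, q n i (T n i)) (ha : ∀ i, q h i (a i)) :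
    next.Path q ⟨s, h, T⟩ ⟨s', ITTM.moveHead d h, Function.update T h a⟩ := by
  refine .single ⟨hT, by simp [step, hn], fun n i => ?_⟩
  by_cases hnh : n = h
  · subst hnh; simpa using ha i
  · simpa [hnh] using hT n i

end TrackNext

/-- The tracks: `.inl none` is the table, `.inl (some i)` is a flag (of which only the bit in
square `0` is used), `.inr none` is the marker track, which serves to find the first square again,
and `.inr (some i)` is a register. -/
abbrev Track (N K : ℕ) := Option (Fin N) ⊕ Option (Fin K)

/-- The marker track. -/
abbrev Track.marker {N K : ℕ} : Track N K := .inr none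

/-- The table. -/
abbrev Track.table {N K : ℕ} : Track N K := .inl none

/-- The track of register `i`. -/
abbrev Track.reg {N K : ℕ} (i : Fin K) : Track N K := .inr (some i)

/-- A part of a machine with tracks, with one entry `start` and two exits `.inr true` and
`.inr false`. -/
structure Frag (ι : Type) where
  State : Type
  finiteState : Finite State
  start : State
  next : State → (ι → Bool) → (ι → Bool) × HeadMove × (State ⊕ Bool)

namespace Frag

variable {ι : Type}

/-- A fragment as a machine that halts at the exits. -/
def toNext (F : Frag ι) : TrackNext (F.State ⊕ Bool) ι
  | .inl s, a => some (F.next s a)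
  | .inr _, _ => none

/-- Started at the first square of the tape `T`, the fragment reaches the exit `e` at the first
square of the tape `T'`, with all bits on the way as required by `q`. -/
def Runs (F : Frag ι) (q : ℕ → ι → Bool → Prop) (T : ℕ → ι → Bool) (e : Bool)
    (T' : ℕ → ι → Bool) : Prop :=
  F.toNext.Path q ⟨.inl F.start, 0, T⟩ ⟨.inr e, 0, T'⟩

theorem Runs.mono {F : Frag ι} {q q' : ℕ → ι → Bool → Prop} {T T' : ℕ → ι → Bool} {e : Bool}
    (h : F.Runs q T e T') (hq : ∀ n i v, q n i v → q' n i v) : F.Runs q' T e T' :=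
  TrackNext.Path.mono h hq

/-- Execution of `F` followed by `G` or an exit, according to the exit of `F`. -/
def link (F G : Frag ι) (k : Bool → G.State ⊕ Bool) : Frag ι where
  State := F.State ⊕ G.State
  finiteState := by have := F.finiteState; have := G.finiteState; infer_instance
  start := .inl F.start
  next
    | .inl s, a => ((F.next s a).1, (F.next s a).2.1,
        Sum.elim (fun s' => .inl (.inl s')) (fun e => (k e).map .inr id) (F.next s a).2.2)
    | .inr s, a => ((G.next s a).1, (G.next s a).2.1, (G.next s a).2.2.map .inr id)

theorem link_path_left {F G : Frag ι} {k : Bool → G.State ⊕ Bool} {q : ℕ → ι → Bool → Prop}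
    {T T' : ℕ → ι → Bool} {e : Bool} (h : F.Runs q T e T') :
    (F.link G k).toNext.Path q ⟨.inl (F.link G k).start, 0, T⟩
      ⟨(k e).map Sum.inr id, 0, T'⟩ := by
  refine TrackNext.Path.map h
    (Sum.elim (fun s' => Sum.inl (Sum.inl s')) (fun e => (k e).map Sum.inr id)) ?_
  rintro (s | s) a p hp
  · simp only [toNext, Option.some.injEq] at hp
    subst hp
    simp [toNext, link]
  · simp [toNext] at hp

theorem link_path_right {F G : Frag ι} {k : Bool → G.State ⊕ Bool} {q : ℕ → ι → Bool → Prop}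
    {a b : TrackConfig _ ι} (h : G.toNext.Path q a b) :
    (F.link G k).toNext.Path q ⟨a.state.map Sum.inr id, a.head, a.tape⟩
      ⟨b.state.map Sum.inr id, b.head, b.tape⟩ := by
  refine TrackNext.Path.map h (Sum.map Sum.inr id) ?_
  rintro (s | s) a p hp
  · simp only [toNext, Option.some.injEq] at hp
    subst hp
    simp [toNext, link]
  · simp [toNext] at hp

/-- Execution of `F`, then of `G`. -/
def seq (F G : Frag ι) : Frag ι := F.link G fun _ => .inl G.start

theorem Runs.seq {F G : Frag ι} {q : ℕ → ι → Bool → Prop} {T T' T'' : ℕ → ι → Bool}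
    {e e' : Bool} (h : F.Runs q T e T') (h' : G.Runs q T' e' T'') :
    (F.seq G).Runs q T e' T'' :=
  (link_path_left h).trans (link_path_right h')

/-- Execution of `F`, then of `G` if the exit of `F` is `.inr true`. -/
def andThen (F G : Frag ι) : Frag ι :=
  F.link G fun e => bif e then .inl G.start else .inr false

theorem Runs.andThen_true {F G : Frag ι} {q : ℕ → ι → Bool → Prop} {T T' T'' : ℕ → ι → Bool}
    {e' : Bool} (h : F.Runs q T true T') (h' : G.Runs q T' e' T'') :
    (F.andThen G).Runs q T e' T'' :=
  (link_path_left h).trans (link_path_right h')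

theorem Runs.andThen_false {F : Frag ι} (G : Frag ι) {q : ℕ → ι → Bool → Prop}
    {T T' : ℕ → ι → Bool} (h : F.Runs q T false T') : (F.andThen G).Runs q T false T' :=
  link_path_left h

/-- Execution of `F` as long as the bit on track `i` of the first square is `1`. -/
def loop (i : ι) (F : Frag ι) : Frag ι where
  State := Option F.State
  finiteState := by have := F.finiteState; infer_instance
  start := none
  next
    | none, a => (a, .left, if a i then .inl (some F.start) else .inr false)
    | some s, a => ((F.next s a).1, (F.next s a).2.1,
        Sum.elim (fun s' => .inl (some s')) (fun _ => .inl none) (F.next s a).2.2)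

theorem loop_runs_false {F : Frag ι} {i : ι} {q : ℕ → ι → Bool → Prop} {T : ℕ → ι → Bool}
    (hq : ∀ n j, q n j (T n j)) (hi : T 0 i = false) : (loop i F).Runs q T false T := by
  have := TrackNext.Path.of_next (next := (loop i F).toNext) (q := q) (s := .inl none) (h := 0)
    (T := T) (a := T 0) (d := .left) (s' := .inr false) (by simp [toNext, loop, hi]) hq (hq 0)
  rwa [Function.update_eq_self] at this

theorem loop_runs_true {F : Frag ι} {i : ι} {q : ℕ → ι → Bool → Prop} {T T' T'' : ℕ → ι → Bool}
    {e e' : Bool} (hq : ∀ n j, q n j (T n j)) (hi : T 0 i = true) (h : F.Runs q T e T')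
    (h' : (loop i F).Runs q T' e' T'') : (loop i F).Runs q T e' T'' := by
  have h1 := TrackNext.Path.of_next (next := (loop i F).toNext) (q := q) (s := .inl none) (h := 0)
    (T := T) (a := T 0) (d := .left) (s' := .inl (some F.start)) (by simp [toNext, loop, hi])
    hq (hq 0)
  rw [Function.update_eq_self] at h1
  refine h1.trans (Relation.TransGen.trans ?_ h')
  refine TrackNext.Path.map h (Sum.elim (fun s' => Sum.inl (some s')) (fun _ => Sum.inl none)) ?_
  rintro (s | s) a p hp
  · simp only [toNext, Option.some.injEq] at hp
    subst hp
    simp [toNext, loop]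
  · simp [toNext] at hp

/-- The fragment that rewrites the first square in one step. -/
def poke (f : (ι → Bool) → ι → Bool) : Frag ι where
  State := Unit
  finiteState := inferInstance
  start := ()
  next _ a := (f a, .left, .inr false)

theorem poke_runs {f : (ι → Bool) → ι → Bool} {q : ℕ → ι → Bool → Prop} {T : ℕ → ι → Bool}
    (hq : ∀ n j, q n j (T n j)) (hf : ∀ j, q 0 j (f (T 0) j)) :
    (poke f).Runs q T false (Function.update T 0 (f (T 0))) :=
  TrackNext.Path.of_next (next := (poke f).toNext) (d := .left) (s := .inl ()) (h := 0) (T := T)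
    (a := f (T 0)) rfl hq hf

end Frag

/-! ### Walks along a track -/

section Walk

variable {N K : ℕ}

/-- The way back to the first square, the only one among those to the left of the head that is not
marked. -/
theorem TrackNext.home_path {S : Type} {next : TrackNext S (Track N K)}
    {q : ℕ → Track N K → Bool → Prop} {s s' : S} {T : ℕ → Track N K → Bool}
    (hs : ∀ a, next s a = some (a, .left, if a .marker then s else s'))
    (hq : ∀ n j, q n j (T n j)) (h0 : T 0 .marker = false) (h : ℕ)
    (hT : ∀ n, n ≠ 0 → n ≤ h → T n .marker = true) :
    next.Path q ⟨s, h, T⟩ ⟨s', 0, T⟩ := by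
  induction h with
  | zero =>
    have := TrackNext.Path.of_next (next := next) (q := q) (h := 0) (T := T) (hs (T 0)) hq (hq 0)
    simpa [h0, ITTM.moveHead] using this
  | succ h ih =>
    have := TrackNext.Path.of_next (next := next) (q := q) (h := h + 1) (T := T) (hs _) hq (hq _)
    rw [hT (h + 1) (by omega) le_rfl, Function.update_eq_self] at this
    exact this.trans (ih fun n hn hnh => hT n hn (by omega))

namespace Frag

/-- The states of a walk: on the way out (`scan f`, where `f` says whether the head is on the first
square), on the square where the way out has ended or next to it (`turn`), and on the way back;
`e` is the exit to be taken. -/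
inductive WalkState where
  | scan (f : Bool)
  | turn (e : Bool)
  | home (e : Bool)

instance : Finite WalkState :=
  Finite.of_injective (fun s : WalkState => match s with
    | .scan f => (none, f) | .turn e => (some false, e) | .home e => (some true, e)) (by
    intro a b; cases a <;> cases b <;> simp)

/-- `a` with the marker that belongs to square `n`. -/
def mark (n : ℕ) (a : Track N K → Bool) : Track N K → Bool :=
  Function.update a .marker (decide (n ≠ 0))

/-- The walk from the first square to the first square with a `0` on track `i`, and back. The
symbols `a` that are passed are replaced by `φ a`, the one at the end by `ψ a`; then the head moves
in direction `d` and replaces the symbol found there by `χ a`. The exit is determined by the bit of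
the table at the end of the way. -/
def walk (i : Track N K) (φ ψ χ : (Track N K → Bool) → Track N K → Bool) (d : HeadMove) :
    Frag (Track N K) where
  State := WalkState
  finiteState := inferInstance
  start := .scan true
  next
    | .scan f, a =>
      if a i then (Function.update (φ a) .marker (!f), .right, .inl (.scan false))
      else (Function.update (ψ a) .marker (!f), d, .inl (.turn (a .table)))
    | .turn e, a => (match d with
        | .left => χ a
        | .right => Function.update (χ a) .marker true, .left, .inl (.home e))
    | .home e, a => (a, .left, if a .marker then .inl (.home e) else .inr e)

/-- The tape at the end of the way out, which is square `r`. -/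
def scanned (φ ψ : (Track N K → Bool) → Track N K → Bool) (T : ℕ → Track N K → Bool) (r n : ℕ) :
    Track N K → Bool :=
  if n < r then mark n (φ (T n)) else if n = r then mark n (ψ (T n)) else T n

/-- The tape after the walk. -/
def walked (φ ψ χ : (Track N K → Bool) → Track N K → Bool) (d : HeadMove)
    (T : ℕ → Track N K → Bool) (r : ℕ) : ℕ → Track N K → Bool :=
  Function.update (scanned φ ψ T r) (ITTM.moveHead d r)
    (mark (ITTM.moveHead d r) (χ (scanned φ ψ T r (ITTM.moveHead d r))))

/-- The number that a track of a tape represents is the position of the first `0` on it. -/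
def Value (T : ℕ → Track N K → Bool) (i : Track N K) (r : ℕ) : Prop :=
  (∀ n < r, T n i = true) ∧ T r i = false

/-- A walk along a track that represents `r` ends on square `r`. A condition on the tape holds
throughout if it holds at the beginning, at the turning point and at the end, since every square in
between has one of these three contents. -/
theorem walk_runs {i : Track N K} {φ ψ χ : (Track N K → Bool) → Track N K → Bool} {d : HeadMove}
    {T : ℕ → Track N K → Bool} {r : ℕ} {q : ℕ → Track N K → Bool → Prop}
    (hχ : ∀ a, χ a .marker = a .marker) (hr : Value T i r)
    (hT : ∀ n j, q n j (T n j)) (hs : ∀ n j, q n j (scanned φ ψ T r n j))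
    (hw : ∀ n j, q n j (walked φ ψ χ d T r n j)) :
    (walk i φ ψ χ d).Runs q T (T r .table) (walked φ ψ χ d T r) := by
  let F : Frag (Track N K) := walk i φ ψ χ d
  have hout : ∀ k ≤ r, Relation.ReflTransGen
      (fun a b => (∀ n i, q n i (a.tape n i)) ∧ F.toNext.step a = some b ∧
        ∀ n i, q n i (b.tape n i))
      ⟨.inl (.scan true), 0, T⟩
      ⟨.inl (.scan (decide (k = 0))), k, fun n => if n < k then mark n (φ (T n)) else T n⟩ := by
    intro k
    induction k with
    | zero => intro _; simpa using Relation.ReflTransGen.refl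
    | succ k ih =>
      intro hk
      have hmid : ∀ k ≤ r, ∀ n j, q n j ((if n < k then mark n (φ (T n)) else T n) j) := by
        intro k hk n j
        split_ifs with h
        · simpa [scanned, show n < r by omega] using hs n j
        · exact hT n j
      refine (ih (by omega)).tail ⟨hmid k (by omega), ?_, hmid (k + 1) hk⟩
      simp only [TrackNext.step, F, toNext, walk, lt_self_iff_false, if_false,
        hr.1 k (by omega), if_true, Option.map_some, ITTM.moveHead, Option.some.injEq,
        TrackConfig.mk.injEq, Nat.succ_ne_zero, decide_false, true_and]
      funext n
      rcases lt_trichotomy n k with h | rfl | h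
      · simp [h.ne, h, show n < k + 1 by omega]
      · simp [mark]
      · simp [h.ne', show ¬ n < k by omega, show ¬ n < k + 1 by omega]
  refine Relation.TransGen.trans_right (hout r le_rfl) ?_
  -- the end of the way out
  have h1 : F.toNext.Path q
      ⟨.inl (.scan (decide (r = 0))), r, fun n => if n < r then mark n (φ (T n)) else T n⟩
      ⟨.inl (.turn (T r .table)), ITTM.moveHead d r, scanned φ ψ T r⟩ := by
    refine .single ⟨fun n j => ?_, ?_, hs⟩
    · dsimp only
      split_ifs with h
      · simpa [scanned, h] using hs n j
      · exact hT n j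
    · simp only [TrackNext.step, F, toNext, walk, lt_self_iff_false, if_false, hr.2,
        Bool.false_eq_true, Option.map_some, Option.some.injEq, TrackConfig.mk.injEq, true_and]
      funext n
      rcases lt_trichotomy n r with h | rfl | h
      · simp [h.ne, h, scanned]
      · simp [mark, scanned]
      · simp [h.ne', show ¬ n < r by omega, scanned]
  have hmark : ∀ n, n ≠ 0 → n ≤ r → scanned φ ψ T r n .marker = true := by
    intro n hn hnr
    rcases hnr.lt_or_eq with h | h
    · simp [scanned, h, mark, hn]
    · simp [scanned, h, mark]; omega
  have hmark0 : scanned φ ψ T r 0 .marker = false := by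
    rcases Nat.eq_zero_or_pos r with h | h
    · simp [scanned, h, mark]
    · simp [scanned, h, mark]
  -- the turn
  have h2 : F.toNext.Path q
      ⟨.inl (.turn (T r .table)), ITTM.moveHead d r, scanned φ ψ T r⟩
      ⟨.inl (.home (T r .table)), ITTM.moveHead d r - 1, walked φ ψ χ d T r⟩ := by
    refine .single ⟨hs, ?_, hw⟩
    simp only [TrackNext.step, F, toNext, walk, Option.map_some, Option.some.injEq,
      TrackConfig.mk.injEq, true_and, walked]
    refine ⟨by cases d <;> simp [ITTM.moveHead], ?_⟩
    congr 1
    cases d with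
    | right => simp [mark, ITTM.moveHead]
    | left =>
      symm
      rw [mark, Function.update_eq_self_iff, hχ]
      by_cases h : ITTM.moveHead .left r = 0
      · rw [h, hmark0]; simp
      · rw [hmark _ h (by simp [ITTM.moveHead])]; simp [h]
  refine h1.trans (h2.trans ?_)
  refine TrackNext.home_path (s := Sum.inl (WalkState.home (T r .table))) (fun a => ?_) hw ?_ _ ?_
  · simp only [F, toNext, walk]
  · by_cases h : ITTM.moveHead d r = 0
    · simp [walked, h, mark]
    · simp [walked, Function.update_of_ne (Ne.symm h), hmark0]
  · intro n hn hnr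
    by_cases h : n = ITTM.moveHead d r
    · subst h; simp [walked, mark, hn]
    · rw [walked, Function.update_of_ne h]
      refine hmark n hn (hnr.trans ?_)
      cases d <;> simp [ITTM.moveHead]; omega

end Frag

end Walk

/-! ### Register programs -/

section Registers

variable {N K : ℕ}

namespace Frag

/-- The tape `T` represents the contents `ρ` of the registers. -/
def Rep (T : ℕ → Track N K → Bool) (ρ : ℕ → ℕ) : Prop := ∀ i : Fin K, Value T (.reg i) (ρ i)

/-- The condition on all bits of a tape that restricts the data tracks only. -/
def OnData (p : ℕ → Option (Fin N) → Bool → Prop) (n : ℕ) (j : Track N K) (v : Bool) : Prop :=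
  ∀ d, j = .inl d → p n d v

/-- The condition that the data tracks are as on the tape `T`. -/
abbrev Keep (T : ℕ → Track N K → Bool) : ℕ → Track N K → Bool → Prop :=
  OnData fun n d v => v = T n (.inl d)

theorem keep_self (T : ℕ → Track N K → Bool) (n : ℕ) (j : Track N K) : Keep T n j (T n j) := by
  rintro d rfl; rfl

theorem Runs.keep {F : Frag (Track N K)} {T T' : ℕ → Track N K → Bool} {e : Bool}
    (h : F.Runs (Keep T) T e T') (n : ℕ) (d : Option (Fin N)) : T' n (.inl d) = T n (.inl d) :=
  TrackNext.Path.good_right h n (.inl d) d rfl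

theorem Keep.trans {T T' : ℕ → Track N K → Bool} (h : ∀ n d, T' n (.inl d) = T n (.inl d))
    (n : ℕ) (j : Track N K) (v : Bool) (hv : Keep T' n j v) : Keep T n j v :=
  fun d hd => (hv d hd).trans (h n d)

/-- The fragment transforms the contents of the registers by `g` without touching the data
tracks. -/
def Computes (F : Frag (Track N K)) (g : (ℕ → ℕ) → ℕ → ℕ) : Prop :=
  ∀ T ρ, Rep T ρ → ∃ e T', Rep T' (g ρ) ∧ F.Runs (Keep T) T e T'

theorem Computes.seq {F G : Frag (Track N K)} {f g : (ℕ → ℕ) → ℕ → ℕ} (hF : F.Computes f)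
    (hG : G.Computes g) : (F.seq G).Computes fun ρ => g (f ρ) := by
  intro T ρ hT
  obtain ⟨e, T', hT', h⟩ := hF T ρ hT
  obtain ⟨e', T'', hT'', h'⟩ := hG T' _ hT'
  exact ⟨e', T'', hT'', h.seq (h'.mono (Keep.trans h.keep))⟩

/-- A loop controlled by a register that its body decreases by one is an iteration. -/
theorem Computes.loop {F : Frag (Track N K)} {f : (ℕ → ℕ) → ℕ → ℕ} (hF : F.Computes f) (i : Fin K)
    (hi : ∀ ρ, f ρ i = ρ i - 1) : (loop (.reg i) F).Computes fun ρ => f^[ρ i] ρ := by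
  have key : ∀ k T ρ, ρ i = k → Rep T ρ → ∃ e T', Rep T' (f^[k] ρ) ∧
      (Frag.loop (.reg i) F).Runs (Keep T) T e T' := by
    intro k
    induction k with
    | zero =>
      intro T ρ hk hT
      have h0 := (hT i).2
      rw [hk] at h0
      exact ⟨false, T, hT, loop_runs_false (keep_self T) h0⟩
    | succ k ih =>
      intro T ρ hk hT
      have h1 := (hT i).1 0 (by omega)
      obtain ⟨e, T', hT', h⟩ := hF T ρ hT
      obtain ⟨e', T'', hT'', h'⟩ := ih T' (f ρ) (by rw [hi, hk]; rfl) hT'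
      exact ⟨e', T'', hT'', loop_runs_true (keep_self T) h1 h (h'.mono (Keep.trans h.keep))⟩
  exact fun T ρ hT => key _ T ρ rfl hT

theorem computes_id : (poke id : Frag (Track N K)).Computes fun ρ => ρ := by
  intro T ρ hT
  have := poke_runs (f := id) (q := Keep T) (T := T) (keep_self T) (keep_self T 0)
  rw [id, Function.update_eq_self] at this
  exact ⟨false, T, hT, this⟩

theorem Computes.iterate {F : Frag (Track N K)} {f : (ℕ → ℕ) → ℕ → ℕ} (hF : F.Computes f)
    (k : ℕ) : ∃ G : Frag (Track N K), G.Computes f^[k] := by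
  induction k with
  | zero => exact ⟨_, computes_id⟩
  | succ k ih =>
    obtain ⟨G, hG⟩ := ih
    exact ⟨_, hF.seq hG⟩

theorem walked_of_fixed {φ ψ χ : (Track N K → Bool) → Track N K → Bool} {d : HeadMove}
    {T : ℕ → Track N K → Bool} {r : ℕ} {j : Track N K} (hj : j ≠ .marker)
    (hφ : ∀ a, φ a j = a j) (hψ : ∀ a, ψ a j = a j) (hχ : ∀ a, χ a j = a j) (n : ℕ) :
    scanned φ ψ T r n j = T n j ∧ walked φ ψ χ d T r n j = T n j := by
  have h1 : ∀ n, scanned φ ψ T r n j = T n j := by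
    intro n
    rw [scanned]
    split_ifs <;> simp [mark, hj, hφ, hψ]
  refine ⟨h1 n, ?_⟩
  by_cases h : n = ITTM.moveHead d r
  · subst h; simp [walked, mark, hj, hχ, h1]
  · simp [walked, Function.update_of_ne h, h1]

theorem Value.congr {T T' : ℕ → Track N K → Bool} {i : Track N K} {r : ℕ} (h : Value T i r)
    (hT : ∀ n, T' n i = T n i) : Value T' i r :=
  ⟨fun n hn => (hT n).trans (h.1 n hn), (hT r).trans h.2⟩

/-- Walks that leave the data tracks alone. -/
theorem walk_computes {i : Fin K} {φ ψ χ : (Track N K → Bool) → Track N K → Bool} {d : HeadMove}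
    {g : (ℕ → ℕ) → ℕ → ℕ} (hφ : ∀ a d, φ a (.inl d) = a (.inl d))
    (hψ : ∀ a d, ψ a (.inl d) = a (.inl d)) (hχ : ∀ a d, χ a (.inl d) = a (.inl d))
    (hχ' : ∀ a, χ a .marker = a .marker)
    (hg : ∀ T ρ, Rep T ρ → Rep (walked φ ψ χ d T (ρ i)) (g ρ)) :
    (walk (.reg i) φ ψ χ d).Computes g := by
  intro T ρ hT
  have h : ∀ n d', scanned φ ψ T (ρ i) n (.inl d') = T n (.inl d') ∧
      walked φ ψ χ d T (ρ i) n (.inl d') = T n (.inl d') := fun n d' =>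
    walked_of_fixed (by simp) (fun a => hφ a d') (fun a => hψ a d') (fun a => hχ a d') n
  refine ⟨_, _, hg T ρ hT, walk_runs hχ' (hT i) (keep_self T) ?_ ?_⟩
  · rintro n j d' rfl; exact (h n d').1
  · rintro n j d' rfl; exact (h n d').2

/-- Adding `1` to register `i`. -/
def incr (i : Fin K) : Frag (Track N K) :=
  walk (.reg i) id (fun a => Function.update a (.reg i) true)
    (fun a => Function.update a (.reg i) false) .right

theorem incr_computes (i : Fin K) :
    (incr i : Frag (Track N K)).Computes fun ρ => Function.update ρ i (ρ i + 1) := by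
  refine walk_computes (by simp) (by simp) (by simp) (by simp) fun T ρ hT j => ?_
  by_cases hj : j = i
  · subst hj
    rw [Function.update_self]
    constructor
    · intro n hn
      have : n ≠ ρ j + 1 := by omega
      rcases Nat.lt_or_ge n (ρ j) with h | h
      · simp [walked, ITTM.moveHead, scanned, mark, this, h, (hT j).1 n h]
      · obtain rfl : n = ρ j := by omega
        simp [walked, ITTM.moveHead, scanned, mark]
    · simp [walked, ITTM.moveHead, mark]
  · rw [Function.update_of_ne (by simpa [Fin.ext_iff] using hj)]
    exact (hT j).congr fun n => (walked_of_fixed (by simp) (by simp) (by simp [hj])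
      (by simp [hj]) n).2

/-- Subtracting `1` from register `i`, unless it is `0`. -/
def decr (i : Fin K) : Frag (Track N K) :=
  walk (.reg i) id id (fun a => Function.update a (.reg i) false) .left

theorem decr_computes (i : Fin K) :
    (decr i : Frag (Track N K)).Computes fun ρ => Function.update ρ i (ρ i - 1) := by
  refine walk_computes (by simp) (by simp) (by simp) (by simp) fun T ρ hT j => ?_
  by_cases hj : j = i
  · subst hj
    rw [Function.update_self]
    constructor
    · intro n hn
      have : n ≠ ρ j - 1 := by omega
      have h : n < ρ j := by omega
      simp [walked, ITTM.moveHead, scanned, mark, this, h, (hT j).1 n h]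
    · simp [walked, ITTM.moveHead, mark]
  · rw [Function.update_of_ne (by simpa [Fin.ext_iff] using hj)]
    exact (hT j).congr fun n => (walked_of_fixed (by simp) (by simp) (by simp)
      (by simp [hj]) n).2

/-- Copying register `i` to register `k`. -/
def copy (i k : Fin K) : Frag (Track N K) :=
  walk (.reg i) (fun a => Function.update a (.reg k) true)
    (fun a => Function.update a (.reg k) false) id .right

theorem copy_computes {i k : Fin K} (hik : i ≠ k) :
    (copy i k : Frag (Track N K)).Computes fun ρ => Function.update ρ k (ρ i) := by
  refine walk_computes (by simp) (by simp) (by simp) (by simp) fun T ρ hT j => ?_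
  by_cases hj : j = k
  · subst hj
    rw [Function.update_self]
    constructor
    · intro n hn
      have : n ≠ ρ i + 1 := by omega
      simp [walked, ITTM.moveHead, scanned, mark, this, hn]
    · simp [walked, ITTM.moveHead, scanned, mark]
  · rw [Function.update_of_ne (by simpa [Fin.ext_iff] using hj)]
    exact (hT j).congr fun n => (walked_of_fixed (by simp) (by simp [hj]) (by simp [hj])
      (by simp) n).2

/-- Resetting register `i` to `0`. -/
def clear (i : Fin K) : Frag (Track N K) := poke fun a => Function.update a (.reg i) false

theorem clear_computes (i : Fin K) :
    (clear i : Frag (Track N K)).Computes fun ρ => Function.update ρ i 0 := by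
  intro T ρ hT
  refine ⟨_, _, ?_, poke_runs (keep_self T) ?_⟩
  · intro j
    by_cases hj : j = i
    · subst hj
      exact ⟨by simp, by simp⟩
    · simp only [Function.update_of_ne (show (j : ℕ) ≠ i by simpa [Fin.ext_iff] using hj)]
      refine (hT j).congr fun n => ?_
      by_cases hn : n = 0
      · subst hn; simp [hj]
      · simp [hn]
  · rintro j d rfl; simp

end Frag

/-! ### Primitive recursive functions as register programs -/

/-- The transformation `g` of register contents is realized by a fragment whenever there are
sufficiently many registers. -/
def Realizable (N : ℕ) (g : (ℕ → ℕ) → ℕ → ℕ) : Prop :=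
  ∃ K₀, ∀ K ≥ K₀, ∃ F : Frag (Track N K), F.Computes g

namespace Realizable

variable {f g : (ℕ → ℕ) → ℕ → ℕ}

theorem comp (hf : Realizable N f) (hg : Realizable N g) : Realizable N fun ρ => g (f ρ) := by
  obtain ⟨k, hk⟩ := hf
  obtain ⟨l, hl⟩ := hg
  refine ⟨max k l, fun K hK => ?_⟩
  obtain ⟨F, hF⟩ := hk K (le_of_max_le_left hK)
  obtain ⟨G, hG⟩ := hl K (le_of_max_le_right hK)
  exact ⟨_, hF.seq hG⟩

theorem id : Realizable N fun ρ => ρ := ⟨0, fun _ _ => ⟨_, Frag.computes_id⟩⟩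

theorem incr (i : ℕ) : Realizable N fun ρ => Function.update ρ i (ρ i + 1) :=
  ⟨i + 1, fun _ hK => ⟨_, Frag.incr_computes ⟨i, hK⟩⟩⟩

theorem decr (i : ℕ) : Realizable N fun ρ => Function.update ρ i (ρ i - 1) :=
  ⟨i + 1, fun _ hK => ⟨_, Frag.decr_computes ⟨i, hK⟩⟩⟩

theorem clear (i : ℕ) : Realizable N fun ρ => Function.update ρ i 0 :=
  ⟨i + 1, fun _ hK => ⟨_, Frag.clear_computes ⟨i, hK⟩⟩⟩

theorem copy {i j : ℕ} (h : i ≠ j) : Realizable N fun ρ => Function.update ρ j (ρ i) :=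
  ⟨max i j + 1, fun K hK => ⟨_, Frag.copy_computes (i := ⟨i, by omega⟩) (k := ⟨j, by omega⟩)
    (by simpa using h)⟩⟩

theorem loop (hf : Realizable N f) (i : ℕ) (hi : ∀ ρ, f ρ i = ρ i - 1) :
    Realizable N fun ρ => f^[ρ i] ρ := by
  obtain ⟨k, hk⟩ := hf
  refine ⟨max k (i + 1), fun K hK => ?_⟩
  obtain ⟨F, hF⟩ := hk K (le_of_max_le_left hK)
  exact ⟨_, hF.loop ⟨i, le_of_max_le_right hK⟩ hi⟩

end Realizable

/-- Every primitive recursive function can be computed into any register `d` from arguments in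
registers below `d`, all of which are preserved; the registers above `d` serve as a workspace,
whose initial contents do not matter. -/
theorem Nat.Primrec'.realizable (N : ℕ) {n : ℕ} {f : List.Vector ℕ n → ℕ} (hf : Nat.Primrec' f) :
    ∀ (d : ℕ) (arg : Fin n → ℕ), (∀ i, arg i < d) → ∃ g, Realizable N g ∧
      ∀ ρ, (∀ j < d, g ρ j = ρ j) ∧ g ρ d = f (List.Vector.ofFn fun i => ρ (arg i)) := by
  induction hf with
  | zero =>
    intro d arg _
    exact ⟨_, Realizable.clear d, fun ρ => ⟨fun j hj => by simp [hj.ne], by simp⟩⟩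
  | succ =>
    intro d arg harg
    refine ⟨_, (Realizable.copy (harg 0).ne).comp (Realizable.incr d),
      fun ρ => ⟨fun j hj => ?_, ?_⟩⟩
    · simp [hj.ne]
    · simp [List.Vector.ofFn]
  | get i =>
    intro d arg harg
    exact ⟨_, Realizable.copy (harg i).ne, fun ρ => ⟨fun j hj => by simp [hj.ne], by simp⟩⟩
  | @comp n m f g hf hg ihf ihg =>
    intro d arg harg
    -- the values of the inner functions are computed into the registers `d, …, d + m - 1`
    have hargs : ∀ k ≤ m, ∃ h, Realizable N h ∧ ∀ ρ, (∀ j < d, h ρ j = ρ j) ∧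
        ∀ i : Fin m, i.val < k → h ρ (d + i) = g i (List.Vector.ofFn fun i => ρ (arg i)) := by
      intro k
      induction k with
      | zero => exact fun _ => ⟨_, Realizable.id, fun ρ => ⟨fun _ _ => rfl, by simp⟩⟩
      | succ k ih =>
        intro hk
        obtain ⟨h, hh, hh'⟩ := ih (by omega)
        obtain ⟨h1, hh1, hh1'⟩ := ihg ⟨k, hk⟩ (d + k) arg fun i => (harg i).trans_le (by omega)
        refine ⟨_, hh.comp hh1, fun ρ => ⟨fun j hj => ?_, fun i hi => ?_⟩⟩
        · rw [(hh1' _).1 j (by omega), (hh' ρ).1 j hj]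
        · by_cases hik : i.val = k
          · obtain rfl : i = ⟨k, hk⟩ := Fin.ext hik
            rw [(hh1' _).2]
            congr 2
            funext l
            exact (hh' ρ).1 _ (harg l)
          · rw [(hh1' _).1 _ (by omega), (hh' ρ).2 i (by omega)]
    obtain ⟨h, hh, hh'⟩ := hargs m le_rfl
    obtain ⟨h1, hh1, hh1'⟩ := ihf (d + m) (fun i => d + i) fun i => by omega
    by_cases hm : m = 0
    · subst hm
      refine ⟨_, hh.comp hh1, fun ρ => ⟨fun j hj => ?_, ?_⟩⟩
      · rw [(hh1' _).1 j (by omega), (hh' ρ).1 j hj]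
      · have := (hh1' (h ρ)).2
        rw [add_zero] at this
        rw [this]
        congr 2
        funext i
        exact i.elim0
    · refine ⟨_, (hh.comp hh1).comp (Realizable.copy (i := d + m) (j := d) (by omega)),
        fun ρ => ⟨fun j hj => ?_, ?_⟩⟩
      · rw [Function.update_of_ne hj.ne, (hh1' _).1 j (by omega), (hh' ρ).1 j hj]
      · rw [Function.update_self, (hh1' _).2]
        congr 2
        funext i
        exact (hh' ρ).2 i i.2
  | @prec n f g hf hg ihf ihg =>
    intro d arg harg
    obtain ⟨h, hh, hh'⟩ := ihf d (fun i => arg i.succ) fun i => harg _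
    -- register `d` holds the last value, `d + 1` its argument, `d + 2` the number of values still
    -- to be computed
    obtain ⟨h1, hh1, hh1'⟩ := ihg (d + 3) (Fin.cons (d + 1) (Fin.cons d fun i => arg i.succ))
      (Fin.cases (by simp) (Fin.cases (by simp) fun i => by
        simpa using (harg i.succ).trans_le (by omega)))
    let body : (ℕ → ℕ) → ℕ → ℕ := fun ρ =>
      Function.update (Function.update (Function.update (h1 ρ) d (h1 ρ (d + 3))) (d + 1)
        (h1 ρ (d + 1) + 1)) (d + 2) (h1 ρ (d + 2) - 1)
    have hbody : Realizable N body := by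
      have := ((hh1.comp (Realizable.copy (i := d + 3) (j := d) (by omega))).comp
        (Realizable.incr (d + 1))).comp (Realizable.decr (d + 2))
      simpa [body] using this
    have hbody1 : ∀ ρ, body ρ (d + 2) = ρ (d + 2) - 1 := fun ρ => by
      simp [body, (hh1' ρ).1 (d + 2) (by omega)]
    have hbody2 : ∀ ρ, body ρ (d + 1) = ρ (d + 1) + 1 := fun ρ => by
      simp [body, (hh1' ρ).1 (d + 1) (by omega)]
    have hbody3 : ∀ ρ, ∀ j < d, body ρ j = ρ j := fun ρ j hj => by
      simp [body, hj.ne, show j ≠ d + 1 by omega, show j ≠ d + 2 by omega,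
        (hh1' ρ).1 j (by omega)]
    have hbody4 : ∀ ρ, body ρ d =
        g (ρ (d + 1) ::ᵥ ρ d ::ᵥ List.Vector.ofFn fun i => ρ (arg i.succ)) := fun ρ => by
      simp [body, (hh1' ρ).2, List.Vector.ofFn]
    refine ⟨_, ((hh.comp (Realizable.clear (d + 1))).comp (Realizable.copy (i := arg 0)
      (j := d + 2) (by have := harg 0; omega))).comp (hbody.loop (d + 2) hbody1), fun ρ => ?_⟩
    have ha0 := harg 0
    have key : ∀ k, let σ := body^[k] (Function.update (Function.update (h ρ) (d + 1) 0) (d + 2)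
          (Function.update (h ρ) (d + 1) 0 (arg 0)))
        (∀ j < d, σ j = ρ j) ∧ σ (d + 1) = k ∧
          σ d = Nat.rec (f (List.Vector.ofFn fun i => ρ (arg i.succ)))
            (fun y IH => g (y ::ᵥ IH ::ᵥ List.Vector.ofFn fun i => ρ (arg i.succ))) k := by
      intro k
      induction k with
      | zero =>
        refine ⟨fun j hj => ?_, by simp, ?_⟩
        · simp [show j ≠ d + 1 by omega, show j ≠ d + 2 by omega, (hh' ρ).1 j hj]
        · simp [(hh' ρ).2]
      | succ k ih =>
        obtain ⟨ih1, ih2, ih3⟩ := ih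
        simp only [Function.iterate_succ_apply']
        refine ⟨fun j hj => ?_, ?_, ?_⟩
        · rw [hbody3 _ j hj, ih1 j hj]
        · rw [hbody2, ih2]
        · rw [hbody4, ih2, ih3]
          congr 4
          funext i
          exact ih1 _ (harg _)
    obtain ⟨h1, -, h3⟩ := key (ρ (arg 0))
    simp only [Function.update_self, Function.update_of_ne (show arg 0 ≠ d + 1 by omega),
      (hh' ρ).1 _ ha0] at h1 h3 ⊢
    refine ⟨h1, h3.trans ?_⟩
    simp [List.Vector.ofFn]

end Registers

/-! ### Machines with tracks at limit times -/

/-- Let a machine with tracks, after reaching `c₁`, run forever through rounds, where `Inv s` is an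
invariant at the beginning of round `s` and `q s` a condition on the tape during this round. At the
limit a bit is `0` if from some round on the conditions force it to be `0`, and it is `1` if the
invariants of infinitely many rounds force it to be `1`. -/
theorem TrackNext.run_add_omega0 {S ι : Type} [Finite S] [Finite ι] {w : ℕ} [NeZero w]
    {next : TrackNext S ι} {enc : ι ≃ Fin w} {start limit : S} {x : ℕ} {t : Ordinal.{0}}
    {q₀ : ℕ → ι → Bool → Prop} {c₀ c₁ : TrackConfig S ι}
    (h0 : (next.toITTM enc start limit).run x t = some (c₀.embed enc next start limit))
    (h1 : next.Path q₀ c₀ c₁) (Inv : ℕ → TrackConfig S ι → Prop) (q : ℕ → ℕ → ι → Bool → Prop)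
    (hc₁ : Inv 0 c₁) (hInv : ∀ s c, Inv s c → ∃ c', Inv (s + 1) c' ∧ next.Path (q s) c c') :
    ∃ T : ℕ → ι → Bool, (next.toITTM enc start limit).run x (t + ω) =
        some ((TrackConfig.mk limit 0 T).embed enc next start limit) ∧
      (∀ n i, (∃ s₀, ∀ s ≥ s₀, ∀ v, q s n i v → v = false) → T n i = false) ∧
      ∀ n i, (∀ s₀, ∃ s ≥ s₀, ∀ c, Inv s c → c.tape n i = true) → T n i = true := by
  obtain ⟨k, -, hk, -⟩ := (h1.toITTM enc start limit).run h0
  choose! f hf hf' using hInv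
  obtain ⟨C, hC0, hCs⟩ : ∃ C : ℕ → TrackConfig S ι, C 0 = c₁ ∧ ∀ s, C (s + 1) = f s (C s) :=
    ⟨fun s => Nat.rec c₁ (fun s c => f s c) s, rfl, fun _ => rfl⟩
  have hCInv : ∀ s, Inv s (C s) := by
    intro s
    induction s with
    | zero => rwa [hC0]
    | succ s ih => rw [hCs]; exact hf s _ ih
  obtain ⟨L, hL, hL0, hL1⟩ := ITTM.run_add_omega0 (M := next.toITTM enc start limit)
    (C := fun s => (C s).embed enc next start limit) (q := fun s => flatCond enc (q s))
    (by rw [hk, hC0]) (fun s => by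
      have := hf' s _ (hCInv s)
      rw [← hCs] at this
      exact this.toITTM enc start limit)
  have hdm : ∀ n (i : ι), (n * w + enc i) / w = n ∧ (n * w + enc i) % w = enc i := by
    intro n i
    rw [mul_comm, Nat.mul_add_div (NeZero.pos w), Nat.div_eq_of_lt (enc i).2, Nat.mul_add_mod,
      Nat.mod_eq_of_lt (enc i).2]
    simp
  have hcond : ∀ s n i v, flatCond enc (q s) (n * w + enc i) v ↔ q s n i v := by
    intro s n i v
    simp [flatCond, hdm n i]
  refine ⟨unflat enc L, ?_, fun n i h => ?_, fun n i h => ?_⟩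
  · rw [add_assoc, Ordinal.natCast_add_omega0] at hL
    rw [hL]
    simp [TrackConfig.embed, flat_unflat, toITTM]
  · refine hL0 _ ?_
    simpa only [hcond] using h
  · refine hL1 _ fun s₀ => ?_
    obtain ⟨s, hs, hs'⟩ := h s₀
    refine ⟨s, hs, ?_⟩
    rw [← hs' _ (hCInv s)]
    simp [TrackConfig.embed, flat_add]

/-! ### The table -/

namespace Frag

variable {N K : ℕ}

/-- Writing `v` into the table at the index that is given by register `i`. The exit is the previous
entry. -/
def setTable (i : Fin K) (v : Bool) : Frag (Track N K) :=
  walk (.reg i) id (fun a => Function.update a .table v) id .right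

theorem setTable_runs {T : ℕ → Track N K → Bool} {ρ : ℕ → ℕ} (hT : Rep T ρ) (i : Fin K) (v : Bool)
    {p : ℕ → Option (Fin N) → Bool → Prop} (hp : ∀ n d, p n d (T n (.inl d)))
    (hv : p (ρ i) none v) : ∃ T', Rep T' ρ ∧
      (∀ n d, T' n (.inl d) = if n = ρ i ∧ d = none then v else T n (.inl d)) ∧
      (setTable i v).Runs (OnData p) T (T (ρ i) .table) T' := by
  have hdata : ∀ n d, scanned id (fun a => Function.update a .table v) T (ρ i) n (.inl d) =
      if n = ρ i ∧ d = none then v else T n (.inl d) := by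
    intro n d
    rcases lt_trichotomy n (ρ i) with h | rfl | h
    · simp [scanned, h, mark, h.ne]
    · by_cases hd : d = none
      · subst hd; simp [scanned, mark]
      · simp [scanned, mark, hd]
    · simp [scanned, h.ne', show ¬ n < ρ i by omega]
  have hdata' : ∀ n d, walked id (fun a => Function.update a .table v) id .right T (ρ i) n
      (.inl d) = if n = ρ i ∧ d = none then v else T n (.inl d) := by
    intro n d
    rw [← hdata]
    by_cases h : n = ITTM.moveHead .right (ρ i)
    · subst h; simp [walked, mark]
    · simp [walked, Function.update_of_ne h]
  have hpq : ∀ n d, p n d (if n = ρ i ∧ d = none then v else T n (.inl d)) := by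
    intro n d
    split_ifs with h
    · rw [h.1, h.2]; exact hv
    · exact hp n d
  refine ⟨_, fun j => ?_, hdata', walk_runs (by simp) (hT i) ?_ ?_ ?_⟩
  · exact (hT j).congr fun n =>
      (walked_of_fixed (by simp) (by simp) (by simp) (by simp) n).2
  · rintro n j d rfl; exact hp n d
  · rintro n j d rfl; rw [hdata]; exact hpq n d
  · rintro n j d rfl; rw [hdata']; exact hpq n d

end Frag

/-! ### Reading the input -/

namespace Frag

variable {N K : ℕ}

/-- The states of the fragment `format`: `scan f` (where `f` says whether the head is on the first
square), `place r` with `r` more bits to write, and `home`. -/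
inductive FormatState (w : ℕ) where
  | scan (f : Bool)
  | place (r : Fin (w + 1))
  | home

instance (w : ℕ) : Finite (FormatState w) :=
  Finite.of_injective (fun s : FormatState w => match s with
    | .scan f => some (Sum.inl f) | .place r => some (.inr r) | .home => none) (by
    intro a b; cases a <;> cases b <;> simp)

/-- The symbol of square `n` that has the bits `u` and `v` on the tracks of the registers `a` and
`b`. -/
def digits (a b : Fin K) (n : ℕ) (u v : Bool) : Track N K → Bool :=
  mark n (Function.update (Function.update (fun _ => false) (.reg b) v) (.reg a) u)

/-- The instruction for the square on which `r` more bits are to be written; `n = 0` says that this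
is the first square. -/
def placeNext (w : ℕ) (a b : Fin K) (n r : ℕ) :
    (Track N K → Bool) × HeadMove × (FormatState w ⊕ Bool) :=
  if r = 0 then (digits a b n false false, .left, .inl .home)
  else (digits a b n false true, .right, .inl (.place (Fin.ofNat _ (r - 1))))

/-- The number of bits `1` of a symbol. -/
def ones (c : Track N K → Bool) : ℕ := (Finset.univ.filter fun j => c j = true).card

/-- The fragment that turns the inscription of the input `x` into register contents. With the
missing `1` in the very first square supplied, the tape carries `x + 1` many `1`s, which fill some
squares with tracks entirely and at most one more partially. Full squares count once for register
`a` and for register `b`, the `1`s in the last square once each for register `b`. -/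
def format (w : ℕ) (a b : Fin K) : Frag (Track N K) where
  State := FormatState w
  finiteState := inferInstance
  start := .scan true
  next
    | .scan f, c =>
      let c' := if f then Function.update c .table true else c
      let n := if f then 0 else 1
      if ∀ j, c' j = true then (digits a b n true true, .right, .inl (.scan false))
      else placeNext w a b n (ones c')
    | .place r, _ => placeNext w a b 1 r
    | .home, c => (c, .left, if c .marker then .inl .home else .inr false)

theorem digits_congr (a b : Fin K) {n m : ℕ} (h : n = 0 ↔ m = 0) (u v : Bool) :
    (digits a b n u v : Track N K → Bool) = digits a b m u v := by
  simp [digits, mark, h]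

theorem placeNext_congr (w : ℕ) (a b : Fin K) {n m : ℕ} (h : n = 0 ↔ m = 0) (r : ℕ) :
    (placeNext w a b n r : (Track N K → Bool) × HeadMove × (FormatState w ⊕ Bool)) =
      placeNext w a b m r := by
  simp [placeNext, digits_congr a b h]

/-- The condition on a tape that is always true. -/
abbrev anything (_ : ℕ) (_ : Track N K) (_ : Bool) : Prop := True

/-- The tape while the fragment `format` writes its last bits. -/
def placed (a b : Fin K) (q : ℕ) (T : ℕ → Track N K → Bool) (k n : ℕ) : Track N K → Bool :=
  if n < q then digits a b n true true else if n < q + k then digits a b n false true else T n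

/-- With `k` bits `1` already placed behind the `q` full squares, the remaining `m` are placed, and
the head returns to the first square. -/
theorem place_path {w : ℕ} {a b : Fin K} {q : ℕ} {T : ℕ → Track N K → Bool} (m : ℕ) :
    ∀ (k : ℕ) (s : FormatState w ⊕ Bool), m ≤ w →
      (format w a b).toNext s (placed a b q T k (q + k)) = some (placeNext w a b (q + k) m) →
      (format w a b).toNext.Path anything ⟨s, q + k, placed a b q T k⟩
        ⟨.inr false, 0, Function.update (placed a b q T (k + m)) (q + k + m)
          (digits a b (q + k + m) false false)⟩ := by
  induction m with
  | zero =>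
    intro k s _ hs
    have h1 := TrackNext.Path.of_next (q := anything) (T := placed a b q T k) (h := q + k) hs
      (fun _ _ => trivial) (fun _ => trivial)
    refine h1.trans ?_
    refine TrackNext.home_path (s := Sum.inl FormatState.home) (fun c => ?_)
      (fun _ _ => trivial) ?_ _ ?_
    · simp only [toNext, format]
    · by_cases h : q + k = 0
      · simp [h, digits, mark]
      · rw [Function.update_of_ne (Ne.symm h)]
        rcases Nat.eq_zero_or_pos q with hq | hq
        · simp [placed, hq, show 0 < k by omega, digits, mark]
        · simp [placed, hq, digits, mark]
    · intro n hn hnh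
      have hnh' : n < q + k := by
        simp only [ITTM.moveHead] at hnh; omega
      rw [Function.update_of_ne hnh'.ne, placed]
      split_ifs <;> simp [digits, mark, hn]
  | succ m ih =>
    intro k s hm hs
    have h1 := TrackNext.Path.of_next (next := (format w a b).toNext) (s := s) (q := anything)
      (T := placed a b q T k) (h := q + k) (d := .right) (a := digits a b (q + k) false true)
      (s' := Sum.inl (FormatState.place (Fin.ofNat (w + 1) m)))
      (by rw [hs]; simp only [placeNext, Nat.succ_ne_zero, if_false, Nat.add_sub_cancel]; rfl)
      (fun _ _ => trivial) (fun _ => trivial)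
    have hT : Function.update (placed a b q T k) (q + k) (digits a b (q + k) false true) =
        placed a b q T (k + 1) := by
      funext n
      rcases lt_trichotomy n (q + k) with h | rfl | h
      · simp [h.ne, placed, h, show n < q + (k + 1) by omega]
      · simp [placed]
      · simp [h.ne', placed, show ¬ n < q + k by omega, show ¬ n < q + (k + 1) by omega]
    rw [hT] at h1
    have h2 := ih (k + 1) (Sum.inl (FormatState.place (Fin.ofNat (w + 1) m))) (by omega) (by
      have : (Fin.ofNat (w + 1) m).val = m := by
        simp [Fin.ofNat, Nat.mod_eq_of_lt (show m < w + 1 by omega)]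
      simp only [toNext, format, this]
      rw [placeNext_congr w a b (show 1 = 0 ↔ q + (k + 1) = 0 by omega)])
    have h3 : k + 1 + m = k + (m + 1) := by omega
    have h4 : q + (k + 1) + m = q + k + (m + 1) := by omega
    rw [h3, h4] at h2
    exact h1.trans h2

/-- Register `a` receives the number of full squares, which is `(x + 1) / w`, and register `b` in
addition the number of `1`s in the last square, which is `(x + 1) % w`. -/
theorem format_runs {w : ℕ} [NeZero w] (enc : Track N K ≃ Fin w) (henc : (enc .table).val = 0)
    {a b : Fin K} (hab : a ≠ b) (x : ℕ) : ∃ T : ℕ → Track N K → Bool,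
      Rep T (fun i => if i = a then (x + 1) / w else
        if i = b then (x + 1) / w + (x + 1) % w else 0) ∧
      (∀ n d, T n (.inl d) = false) ∧
      (format w a b).Runs anything (TrackNext.unflat enc (ITTM.inputTape x)) false T := by
  have hqr := Nat.div_add_mod' (x + 1) w
  have hrw : (x + 1) % w < w := Nat.mod_lt _ (NeZero.pos w)
  generalize (x + 1) / w = q at *
  generalize (x + 1) % w = r at *
  set I := TrackNext.unflat enc (ITTM.inputTape x) with hI
  -- the symbol that is taken into account on square `n`
  have hread : ∀ n j, (if n = 0 then Function.update (I n) .table true else I n) j =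
      decide (n * w + enc j < x + 1) := by
    intro n j
    by_cases hn : n = 0
    · subst hn
      by_cases hj : j = .table
      · subst hj; simp [henc]
      · have : (enc j).val ≠ 0 := fun h => hj (enc.injective (Fin.ext (h.trans henc.symm)))
        simp only [if_true, ne_eq, hj, not_false_eq_true, Function.update_of_ne, I,
          TrackNext.unflat, ITTM.inputTape, zero_mul, zero_add, decide_eq_decide]
        omega
    · have : 0 < n * w := Nat.mul_pos (by omega) (NeZero.pos w)
      simp only [hn, if_false, I, TrackNext.unflat, ITTM.inputTape, decide_eq_decide]
      omega
  have hmul : ∀ {n m : ℕ}, n < m → n * w + w ≤ m * w := by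
    intro n m h
    calc n * w + w = (n + 1) * w := by ring
      _ ≤ m * w := Nat.mul_le_mul_right _ h
  have hfull : ∀ n < q, ∀ j, (if n = 0 then Function.update (I n) .table true else I n) j
      = true := by
    intro n hn j
    rw [hread, decide_eq_true_eq]
    have := hmul hn
    have := (enc j).2
    omega
  have hlast : ones (if q = 0 then Function.update (I q) .table true else I q) = r := by
    have : ones (if q = 0 then Function.update (I q) .table true else I q) =
        (Finset.univ.filter fun k : Fin w => k.val < r).card := by
      rw [ones]
      refine Finset.card_equiv enc fun j => ?_
      simp only [Finset.mem_filter, Finset.mem_univ, true_and, hread, decide_eq_true_eq]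
      omega
    rw [this, Fin.card_filter_val_lt]
    omega
  have hnotfull : ¬ ∀ j, (if q = 0 then Function.update (I q) .table true else I q) j = true := by
    intro h
    have := h (enc.symm ⟨r, hrw⟩)
    rw [hread] at this
    simp at this
    omega
  have hempty : ∀ n j, q < n → I n j = false := by
    intro n j hn
    have := hread n j
    rw [if_neg (by omega)] at this
    rw [this, decide_eq_false_iff_not]
    have := hmul hn
    omega
  -- the full squares
  have hscan : ∀ k ≤ q, Relation.ReflTransGen
      (fun c c' => (∀ n i, anything n i (c.tape n i)) ∧ (format w a b).toNext.step c = some c' ∧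
        ∀ n i, anything n i (c'.tape n i))
      ⟨.inl (.scan true), 0, I⟩
      ⟨.inl (.scan (decide (k = 0))), k,
        fun n => if n < k then digits a b n true true else I n⟩ := by
    intro k
    induction k with
    | zero => intro _; simpa using Relation.ReflTransGen.refl
    | succ k ih =>
      intro hk
      refine (ih (by omega)).tail ⟨fun _ _ => trivial, ?_, fun _ _ => trivial⟩
      have h1 := hfull k (by omega)
      simp only [TrackNext.step, toNext, format, lt_self_iff_false, if_false, decide_eq_true_eq,
        if_pos h1, Option.map_some, ITTM.moveHead, Option.some.injEq,
        TrackConfig.mk.injEq, Nat.succ_ne_zero, decide_false, true_and]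
      funext n
      rcases lt_trichotomy n k with h | rfl | h
      · simp [h.ne, h, show n < k + 1 by omega]
      · simp only [Function.update_self, Nat.lt_succ_self, if_true]
        exact digits_congr a b (by by_cases h : n = 0 <;> simp [h]) _ _
      · simp [h.ne', show ¬ n < k by omega, show ¬ n < k + 1 by omega]
  have hpl : (fun n => if n < q then digits a b n true true else I n) = placed a b q I 0 := by
    funext n
    simp only [placed, add_zero]
    split_ifs <;> rfl
  have hscan' := hscan q le_rfl
  rw [hpl] at hscan'
  have hplace := place_path (w := w) (a := a) (b := b) (q := q) (T := I) r 0
    (.inl (.scan (decide (q = 0)))) hrw.le (by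
      simp only [toNext, format, placed, add_zero, lt_self_iff_false, if_false, decide_eq_true_eq,
        if_neg hnotfull, hlast, Option.some.injEq]
      exact placeNext_congr w a b (by by_cases h : q = 0 <;> simp [h]) _)
  simp only [add_zero, zero_add] at hplace
  refine ⟨_, ?_, ?_, Relation.TransGen.trans_right hscan' hplace⟩
  · intro i
    by_cases hi : i = a
    · subst hi
      simp only [if_true]
      constructor
      · intro n hn
        simp [show n ≠ q + r by omega, placed, hn, digits, mark]
      · by_cases h0 : r = 0
        · simp [h0, digits, mark]
        · simp [h0, placed, show 0 < r by omega, digits, mark]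
    · simp only [if_neg (show (i : ℕ) ≠ a by simpa [Fin.ext_iff] using hi)]
      by_cases hi' : i = b
      · subst hi'
        simp only [if_true]
        constructor
        · intro n hn
          rw [Function.update_of_ne hn.ne, placed]
          split_ifs <;> simp [digits, mark, hi]
        · simp [digits, mark]
      · simp only [if_neg (show (i : ℕ) ≠ b by simpa [Fin.ext_iff] using hi')]
        refine ⟨by simp, ?_⟩
        by_cases h : 0 = q + r
        · simp [← h, digits, mark]
        · rw [Function.update_of_ne h, placed]
          split_ifs
          · simp [digits, mark, hi, hi']
          · simp [digits, mark, hi, hi']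
          · omega
  · intro n d
    by_cases h : n = q + r
    · subst h; simp [digits, mark]
    · rw [Function.update_of_ne h, placed]
      split_ifs
      · simp [digits, mark]
      · simp [digits, mark]
      · exact hempty n _ (by omega)

end Frag

/-! ### The decision machine -/

namespace Frag

variable {N K : ℕ}

/-- The symbol of the first square with which a stage after a limit starts: the table is kept, one
more flag is set, and all registers are `0`. -/
def nextStage (c : Track N K → Bool) : Track N K → Bool
  | .inl none => c (.inl none)
  | .inl (some i) => decide (∀ i' < i, c (.inl (some i')) = true)
  | .inr _ => false

/-- The machine that executes `I` and then `B` again and again. In the limit state, which is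
`.inr none`, it halts if all flags are set; otherwise it sets one more flag and then executes `B'`
again and again. -/
def assemble (I B B' : Frag (Track N K)) :
    TrackNext ((I.State ⊕ B.State) ⊕ Option B'.State) (Track N K)
  | .inl (.inl s), c => some ((I.next s c).1, (I.next s c).2.1,
      Sum.elim (fun s' => .inl (.inl s')) (fun _ => .inl (.inr B.start)) (I.next s c).2.2)
  | .inl (.inr s), c => some ((B.next s c).1, (B.next s c).2.1,
      Sum.elim (fun s' => .inl (.inr s')) (fun _ => .inl (.inr B.start)) (B.next s c).2.2)
  | .inr (some s), c => some ((B'.next s c).1, (B'.next s c).2.1,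
      Sum.elim (fun s' => .inr (some s')) (fun _ => .inr (some B'.start)) (B'.next s c).2.2)
  | .inr none, c =>
      if ∀ i, c (.inl (some i)) = true then none
      else some (nextStage c, .left, .inr (some B'.start))

variable {I B B' : Frag (Track N K)} {q : ℕ → Track N K → Bool → Prop}
  {T T' : ℕ → Track N K → Bool} {e : Bool}

theorem Runs.assemble_init (h : I.Runs q T e T') :
    (assemble I B B').Path q ⟨.inl (.inl I.start), 0, T⟩ ⟨.inl (.inr B.start), 0, T'⟩ := by
  refine TrackNext.Path.map h
    (Sum.elim (fun s' => Sum.inl (Sum.inl s')) (fun _ => Sum.inl (Sum.inr B.start))) ?_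
  rintro (s | s) a p hp
  · simp only [toNext, Option.some.injEq] at hp
    subst hp
    simp [assemble]
  · simp [toNext] at hp

theorem Runs.assemble_first (h : B.Runs q T e T') :
    (assemble I B B').Path q ⟨.inl (.inr B.start), 0, T⟩ ⟨.inl (.inr B.start), 0, T'⟩ := by
  refine TrackNext.Path.map h
    (Sum.elim (fun s' => Sum.inl (Sum.inr s')) (fun _ => Sum.inl (Sum.inr B.start))) ?_
  rintro (s | s) a p hp
  · simp only [toNext, Option.some.injEq] at hp
    subst hp
    simp [assemble]
  · simp [toNext] at hp

theorem Runs.assemble_later (h : B'.Runs q T e T') :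
    (assemble I B B').Path q ⟨.inr (some B'.start), 0, T⟩ ⟨.inr (some B'.start), 0, T'⟩ := by
  refine TrackNext.Path.map h
    (Sum.elim (fun s' => Sum.inr (some s')) (fun _ => Sum.inr (some B'.start))) ?_
  rintro (s | s) a p hp
  · simp only [toNext, Option.some.injEq] at hp
    subst hp
    simp [assemble]
  · simp [toNext] at hp

theorem Keep.onData {p : ℕ → Option (Fin N) → Bool → Prop} {T : ℕ → Track N K → Bool}
    (h : ∀ n d, p n d (T n (.inl d))) (n : ℕ) (j : Track N K) (v : Bool) (hv : Keep T n j v) :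
    OnData p n j v :=
  fun d hd => by rw [hv d hd]; exact h n d

end Frag

/-- The operation on tables that one stage after a limit performs. -/
def nor (T : ℕ → Prop) (m : ℕ) : Prop := ∀ t, (Nat.unpair t).1 = m → ¬ T t

namespace Frag

variable {N : ℕ}

/-- When registers `1` and `2` contain `x + 1` and `s`, and the table has no `1` except possibly at
the index in register `3`, the fragment increases register `2` to `s + 1` and moves the `1` of the
table to the index `e x (s + 1)`, which it leaves in register `3`. In the meantime there is no `1`
at any other index. -/
def Flashes {K : ℕ} (B : Frag (Track N K)) (e : ℕ → ℕ → ℕ) : Prop :=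
  ∀ (T : ℕ → Track N K → Bool) (ρ : ℕ → ℕ) (x s : ℕ) (p : ℕ → Option (Fin N) → Bool → Prop),
    Rep T ρ → ρ 1 = x + 1 → ρ 2 = s →
    (∀ n d v, (d = none → v = true → n = ρ 3 ∨ n = e x (s + 1)) → (d ≠ none → v = false) →
      p n d v) →
    (∀ n d, T n (.inl d) = true → n = ρ 3 ∧ d = none) →
    ∃ b T' ρ', Rep T' ρ' ∧ ρ' 1 = x + 1 ∧ ρ' 2 = s + 1 ∧ ρ' 3 = e x (s + 1) ∧
      (∀ n d, T' n (.inl d) = true ↔ n = e x (s + 1) ∧ d = none) ∧ B.Runs (OnData p) T b T'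

/-- When register `0` contains `s`, the fragment replaces entry `s` of the table by `1` and then, if
that entry was `1`, replaces the entry whose index is the first component of `s` by `0`. Finally it
increases register `0` to `s + 1`. -/
def StepsNor {K : ℕ} (B : Frag (Track N K)) : Prop :=
  ∀ (T : ℕ → Track N K → Bool) (ρ : ℕ → ℕ) (s : ℕ) (p : ℕ → Option (Fin N) → Bool → Prop),
    Rep T ρ → ρ 0 = s → (∀ n d, p n d (T n (.inl d))) → p s none true → (∀ n, p n none false) →
    ∃ b T' ρ', Rep T' ρ' ∧ ρ' 0 = s + 1 ∧
      (∀ n d, T' n (.inl d) = if n = (Nat.unpair s).1 ∧ d = none ∧ T s .table = true then false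
        else if n = s ∧ d = none then true else T n (.inl d)) ∧
      B.Runs (OnData p) T b T'

/-- The old `1` is erased before the new one is written, so at most one entry is `1` at any time. -/
theorem exists_flashes {e : ℕ → ℕ → ℕ} (he : Primrec₂ e) (N : ℕ) :
    ∃ K₀, ∀ K ≥ K₀, ∃ B : Frag (Track N K), B.Flashes e := by
  have hE : Primrec₂ fun b s => e (b - 1) s :=
    he.comp (Primrec.pred.comp Primrec.fst) Primrec.snd
  obtain ⟨g, ⟨K₀, hK₀⟩, hg⟩ := (Nat.Primrec'.prim_iff₂.2 hE).realizable N 3 ![1, 2] (by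
    intro i; fin_cases i <;> simp)
  refine ⟨max K₀ 4, fun K hK => ?_⟩
  obtain ⟨G, hG⟩ := hK₀ K (le_of_max_le_left hK)
  have hK4 : 4 ≤ K := le_of_max_le_right hK
  let r : Fin K := ⟨3, by omega⟩
  refine ⟨(((setTable r false).seq (incr ⟨2, by omega⟩)).seq G).seq (setTable r true),
    fun T ρ x s p hT h1 h2 hp hTd => ?_⟩
  have hfalse : ∀ n d, p n d false := fun n d => hp n d _ (by simp) (by simp)
  obtain ⟨T1, hT1, hd1, hr1⟩ := setTable_runs hT r false (p := p)
    (fun n d => hp n d _ (fun hd h => .inl (hTd n d h).1)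
      fun hd => by by_contra h; exact hd (hTd n d (by simpa using h)).2) (hfalse _ _)
  have hd1' : ∀ n d, T1 n (.inl d) = false := by
    intro n d
    rw [hd1]
    split_ifs with h
    · rfl
    · by_contra h'; exact h (hTd n d (by simpa using h'))
  obtain ⟨b2, T2, hT2, hr2⟩ := incr_computes (N := N) (⟨2, by omega⟩ : Fin K) T1 ρ hT1
  obtain ⟨b3, T3, hT3, hr3⟩ := hG T2 _ hT2
  have hd2 : ∀ n d, T2 n (.inl d) = false := fun n d => (hr2.keep n d).trans (hd1' n d)
  have hd3 : ∀ n d, T3 n (.inl d) = false := fun n d => (hr3.keep n d).trans (hd2 n d)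
  obtain ⟨hg1, hg2⟩ := hg (Function.update ρ 2 (ρ 2 + 1))
  have h3 : g (Function.update ρ 2 (ρ 2 + 1)) 3 = e x (s + 1) := by
    rw [hg2]
    simp [List.Vector.ofFn, List.Vector.head, List.Vector.tail, List.Vector.cons, h1, h2]
  obtain ⟨T4, hT4, hd4, hr4⟩ := setTable_runs hT3 r true (p := p)
    (fun n d => by rw [hd3]; exact hfalse n d)
    (hp _ _ _ (fun _ _ => .inr h3) (by simp))
  refine ⟨_, T4, _, hT4, ?_, ?_, h3, fun n d => ?_, ((hr1.seq (hr2.mono ?_)).seq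
    (hr3.mono ?_)).seq hr4⟩
  · simp [hg1 1 (by omega), h1]
  · exact (hg1 2 (by omega)).trans (by simp [h2])
  · rw [hd4, hd3]
    simp [r, h3]
  · exact Keep.onData fun n d => by rw [hd1']; exact hfalse n d
  · exact Keep.onData fun n d => by rw [hd2]; exact hfalse n d

/-- Entry `s` is set to `1` first: if it was `1` and `s` is its own first component, it must end up
as `0`. -/
theorem exists_stepsNor (N : ℕ) : ∃ K₀, ∀ K ≥ K₀, ∃ B : Frag (Track N K), B.StepsNor := by
  have hE : Primrec fun s => (Nat.unpair s).1 := Primrec.fst.comp Primrec.unpair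
  obtain ⟨g, ⟨K₀, hK₀⟩, hg⟩ := (Nat.Primrec'.prim_iff₁.2 hE).realizable N 1 ![0] (by simp)
  refine ⟨max K₀ 2, fun K hK => ?_⟩
  obtain ⟨G, hG⟩ := hK₀ K (le_of_max_le_left hK)
  have hK2 : 2 ≤ K := le_of_max_le_right hK
  let r : Fin K := ⟨0, by omega⟩
  let m : Fin K := ⟨1, by omega⟩
  refine ⟨(G.seq ((setTable r true).andThen (setTable m false))).seq (incr r),
    fun T ρ s p hT h0 hp hpt hpf => ?_⟩
  obtain ⟨b1, T1, hT1, hr1⟩ := hG T ρ hT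
  obtain ⟨hg1, hg2⟩ := hg ρ
  have h1 : g ρ 1 = (Nat.unpair s).1 := by
    rw [hg2]
    simp [List.Vector.ofFn, List.Vector.head, List.Vector.cons, h0]
  have h0' : g ρ 0 = s := by rw [hg1 0 one_pos, h0]
  have hd1 : ∀ n d, T1 n (.inl d) = T n (.inl d) := hr1.keep
  obtain ⟨T2, hT2, hd2, hr2⟩ := setTable_runs hT1 r true (p := p)
    (fun n d => by rw [hd1]; exact hp n d) (by simpa [r, h0'] using hpt)
  have hp2 : ∀ n d, p n d (T2 n (.inl d)) := TrackNext.Path.good_right hr2 |>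
    fun h n d => h n (.inl d) d rfl
  have hexit : T1 (g ρ r) .table = T s .table := by
    simp only [r, h0']; exact hd1 s none
  rw [hexit] at hr2
  -- the two cases come together before the last step
  obtain ⟨b3, T3, hT3, hd3, hr3⟩ : ∃ b3 T3, Rep T3 (g ρ) ∧
      (∀ n d, T3 n (.inl d) = if n = (Nat.unpair s).1 ∧ d = none ∧ T s .table = true then false
          else if n = s ∧ d = none then true else T n (.inl d)) ∧
      ((setTable r true).andThen (setTable m false)).Runs (OnData p) T1 b3 T3 := by
    cases hb : T s .table with
    | false =>
      rw [hb] at hr2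
      refine ⟨_, T2, hT2, fun n d => ?_, hr2.andThen_false _⟩
      rw [hd2, hd1]
      simp [r, h0']
    | true =>
      rw [hb] at hr2
      obtain ⟨T3, hT3, hd3, hr3⟩ := setTable_runs hT2 m false (p := p) hp2 (hpf _)
      refine ⟨_, T3, hT3, fun n d => ?_, hr2.andThen_true hr3⟩
      rw [hd3, hd2, hd1]
      simp [r, m, h0', h1]
  obtain ⟨b4, T4, hT4, hr4⟩ := incr_computes (N := N) r T3 _ hT3
  have hp3 : ∀ n d, p n d (T3 n (.inl d)) := TrackNext.Path.good_right hr3 |>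
    fun h n d => h n (.inl d) d rfl
  refine ⟨_, T4, _, hT4, by simp [r, h0'], fun n d => (hr4.keep n d).trans (hd3 n d),
    ((hr1.mono (Keep.onData hp)).seq hr3).seq (hr4.mono (Keep.onData hp3))⟩

/-- A fragment that turns the inscription of the input `x` into the register contents with which the
fragment of `exists_flashes` can be executed repeatedly. -/
theorem exists_init {N K w : ℕ} [NeZero w] (hK : 4 ≤ K) (enc : Track N K ≃ Fin w)
    (henc : (enc .table).val = 0) : ∃ I : Frag (Track N K), ∀ x, ∃ b T ρ, Rep T ρ ∧
      ρ 1 = x + 1 ∧ ρ 2 = 0 ∧ (∀ n d, T n (.inl d) = false) ∧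
      I.Runs anything (TrackNext.unflat enc (ITTM.inputTape x)) b T := by
  let a : Fin K := ⟨0, by omega⟩
  let b : Fin K := ⟨1, by omega⟩
  obtain ⟨F, hF⟩ := (incr_computes (N := N) b).iterate (w - 1)
  let f : (ℕ → ℕ) → ℕ → ℕ := fun ρ => Function.update ρ 1 (ρ 1 + 1)
  have hf : ∀ k ρ j, f^[k] ρ j = if j = 1 then ρ 1 + k else ρ j := by
    intro k
    induction k with
    | zero => intro ρ j; by_cases hj : j = 1 <;> simp [hj]
    | succ k ih =>
      intro ρ j
      have : f (f^[k] ρ) j = if j = 1 then f^[k] ρ 1 + 1 else f^[k] ρ j :=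
        Function.update_apply _ _ _ _
      rw [Function.iterate_succ_apply', this]
      by_cases hj : j = 1 <;> simp [hj, ih, add_assoc]
  have hbody := hF.seq (decr_computes (N := N) a)
  have hL := hbody.loop a (fun ρ => by
    have := hf (w - 1) ρ 0
    simp only [a, Function.update_self]
    simp only [f] at this
    simp [b, this])
  -- the quotient in `a` counts for `w` each; it is contained in `b` once already
  refine ⟨(format w a b).seq (loop (.reg a) (F.seq (decr a))), fun x => ?_⟩
  obtain ⟨T, hT, hd, hr⟩ := format_runs enc henc (show a ≠ b by simp [a, b]) x
  obtain ⟨e', T', hT', hr'⟩ := hL T _ hT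
  have key : ∀ k ρ,
      (fun ρ : ℕ → ℕ => Function.update (f^[w - 1] ρ) 0 (f^[w - 1] ρ 0 - 1))^[k] ρ 1 =
        ρ 1 + k * (w - 1) ∧
      (fun ρ : ℕ → ℕ => Function.update (f^[w - 1] ρ) 0 (f^[w - 1] ρ 0 - 1))^[k] ρ 2 = ρ 2 := by
    intro k
    induction k with
    | zero => simp
    | succ k ih =>
      intro ρ
      rw [Function.iterate_succ_apply, (ih _).1, (ih _).2]
      simp only [Function.update_apply, hf]
      simp
      ring
  refine ⟨e', T', _, hT', ?_, ?_, fun n d => (hr'.keep n d).trans (hd n d),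
    hr.seq (hr'.mono fun _ _ _ _ => trivial)⟩
  · refine (key _ _).1.trans ?_
    have h1 := Nat.div_add_mod' (x + 1) w
    obtain ⟨v, hv⟩ := Nat.exists_eq_succ_of_ne_zero (NeZero.ne w)
    have h2 : (x + 1) / w * w = (x + 1) / w * (w - 1) + (x + 1) / w := by
      conv_lhs => rw [show w = (w - 1) + 1 by omega, ← show w = (w - 1) + 1 by omega]
      rw [hv]; simp; ring
    simp [a, b]
    omega
  · refine (key _ _).2.trans ?_
    simp [a, b]

end Frag

/-- The numbers that a sequence takes infinitely often as a value. -/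
def hits (f : ℕ → ℕ) (n : ℕ) : Prop := ∀ s₀, ∃ s ≥ s₀, f s = n

namespace Frag

/-- The table can be made the first track of the interleaving, so that entry `0` of the table is on
the first square, where the output is read. -/
theorem exists_enc (N K : ℕ) : ∃ (w : ℕ) (_ : NeZero w) (enc : Track N K ≃ Fin w),
    (enc .table).val = 0 := by
  have : NeZero (Fintype.card (Track N K)) := ⟨Fintype.card_ne_zero⟩
  refine ⟨_, this, (Fintype.equivFin (Track N K)).trans
    (Equiv.swap (Fintype.equivFin _ .table) 0), ?_⟩
  simp

/-- The first stage: the table fills with the numbers that `e x` takes infinitely often. -/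
theorem first_stage {N K w : ℕ} [NeZero w] {enc : Track N K ≃ Fin w} {I B B' : Frag (Track N K)}
    [Finite I.State] [Finite B.State] [Finite B'.State] {e : ℕ → ℕ → ℕ} {x : ℕ} {b₀ : Bool}
    {T₀ : ℕ → Track N K → Bool} {ρ₀ : ℕ → ℕ}
    (hI : I.Runs anything (TrackNext.unflat enc (ITTM.inputTape x)) b₀ T₀)
    (hT₀ : Rep T₀ ρ₀) (h1 : ρ₀ 1 = x + 1) (h2 : ρ₀ 2 = 0) (hd : ∀ n d, T₀ n (.inl d) = false)
    (hB : B.Flashes e) :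
    ∃ T, ((assemble I B B').toITTM enc (.inl (.inl I.start)) (.inr none)).run x ω =
        some ((TrackConfig.mk (.inr none) 0 T).embed enc (assemble I B B') (.inl (.inl I.start))
          (.inr none)) ∧
      (∀ n, T n .table = true ↔ hits (e x) n) ∧ ∀ i, T 0 (.inl (some i)) = false := by
  let Inv : ℕ → TrackConfig ((I.State ⊕ B.State) ⊕ Option B'.State) (Track N K) → Prop :=
    fun s c => c.state = .inl (.inr B.start) ∧ c.head = 0 ∧ ∃ ρ, Rep c.tape ρ ∧ ρ 1 = x + 1 ∧
      ρ 2 = s ∧ (∀ n d, c.tape n (.inl d) = true → n = ρ 3 ∧ d = none) ∧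
      (s ≠ 0 → ρ 3 = e x s ∧ c.tape (e x s) .table = true)
  -- during round `s` only the entries `e x s` and `e x (s + 1)` of the table can be `1`; before
  -- round `0` register `3` need not contain a value of `e x`
  let p : ℕ → ℕ → Option (Fin N) → Bool → Prop := fun s n d v =>
    (d = none → v = true → s ≠ 0 → n = e x s ∨ n = e x (s + 1)) ∧ (d ≠ none → v = false)
  have h0 : ((assemble I B B').toITTM enc (.inl (.inl I.start)) (.inr none)).run x 0 =
      some ((TrackConfig.mk (.inl (.inl I.start)) 0
        (TrackNext.unflat enc (ITTM.inputTape x))).embed enc (assemble I B B')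
          (.inl (.inl I.start)) (.inr none)) := by
    rw [ITTM.run_zero]
    simp [ITTM.init, TrackConfig.embed, TrackNext.flat_unflat, TrackNext.toITTM]
  obtain ⟨T, hT, hT0, hT1⟩ := TrackNext.run_add_omega0 h0 hI.assemble_init Inv
    (fun s => OnData (p s)) ⟨rfl, rfl, ρ₀, hT₀, h1, h2, by simp [hd], by simp⟩ (by
      rintro s ⟨_, _, T⟩ ⟨rfl, rfl, ρ, hTρ, h1, h2, hd, he⟩
      obtain ⟨b, T', ρ', hT', h1', h2', h3', hd', hr⟩ := hB T ρ x s (p s) hTρ h1 h2 (by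
        intro n d v hv1 hv2
        refine ⟨fun h h' hs => ?_, hv2⟩
        rw [← (he hs).1]
        exact hv1 h h') hd
      refine ⟨⟨_, 0, T'⟩, ⟨rfl, rfl, ρ', hT', h1', h2', fun n d h => ?_, fun _ => ⟨h3', ?_⟩⟩,
        hr.assemble_first⟩
      · rw [h3']; exact (hd' n d).1 h
      · exact (hd' _ _).2 ⟨rfl, rfl⟩)
  rw [zero_add] at hT
  refine ⟨T, hT, fun n => ?_, fun i => ?_⟩
  · constructor
    · intro h
      by_contra hn
      simp only [hits, not_forall, not_exists, not_and] at hn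
      obtain ⟨s₀, hs₀⟩ := hn
      have := hT0 n .table ⟨max s₀ 1, fun s hs v hv => by
        by_contra hv'
        rcases (hv none rfl).1 rfl (by simpa using hv') (by omega) with h | h
        · exact hs₀ s (by omega) h.symm
        · exact hs₀ (s + 1) (by omega) h.symm⟩
      rw [h] at this
      cases this
    · intro h
      refine hT1 n .table fun s₀ => ?_
      obtain ⟨s, hs, rfl⟩ := h (max s₀ 1)
      refine ⟨s, by omega, ?_⟩
      rintro ⟨_, _, T⟩ ⟨rfl, rfl, ρ, hTρ, h1, h2, hd, he⟩
      exact (he (by omega)).2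
  · exact hT0 0 _ ⟨0, fun s _ v hv => (hv (some i) rfl).2 (by simp)⟩

/-- The later stages: the operation `nor` is applied to the table, and one more flag is set. -/
theorem later_stage {N K w : ℕ} [NeZero w] {enc : Track N K ≃ Fin w} {I B B' : Frag (Track N K)}
    [Finite I.State] [Finite B.State] [Finite B'.State] {x : ℕ} {t : Ordinal.{0}} {k : ℕ}
    {T₀ : ℕ → Track N K → Bool} (hk : k < N)
    (h0 : ((assemble I B B').toITTM enc (.inl (.inl I.start)) (.inr none)).run x t =
        some ((TrackConfig.mk (.inr none) 0 T₀).embed enc (assemble I B B') (.inl (.inl I.start))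
          (.inr none)))
    (hflag : ∀ i : Fin N, T₀ 0 (.inl (some i)) = decide (i.val < k))
    (hB : B'.StepsNor) :
    ∃ T, ((assemble I B B').toITTM enc (.inl (.inl I.start)) (.inr none)).run x (t + ω) =
        some ((TrackConfig.mk (.inr none) 0 T).embed enc (assemble I B B') (.inl (.inl I.start))
          (.inr none)) ∧
      (∀ n, T n .table = true ↔ nor (fun n => T₀ n .table = true) n) ∧
      ∀ i : Fin N, T 0 (.inl (some i)) = decide (i.val < k + 1) := by
  classical
  -- the first step after the limit
  have hnext : assemble I B B' (.inr none) (T₀ 0) =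
      some (nextStage (T₀ 0), .left, .inr (some B'.start)) := by
    simp only [assemble]
    rw [if_neg]
    intro h
    have := h ⟨k, hk⟩
    rw [hflag] at this
    simp at this
  have hstep := TrackNext.Path.of_next (q := anything) (T := T₀) (h := 0) hnext
    (fun _ _ => trivial) (fun _ => trivial)
  have hflag' : ∀ i : Fin N, nextStage (T₀ 0) (.inl (some i)) = decide (i.val < k + 1) := by
    intro i
    simp only [nextStage, hflag, decide_eq_true_eq, decide_eq_decide]
    constructor
    · intro h
      by_contra hik
      have := h ⟨k, hk⟩ (by rw [Fin.lt_def]; simp; omega)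
      simp at this
    · intro h i' hi'
      have : i'.val < i.val := hi'
      omega
  -- the table at the beginning of round `s`: entries below `s` have their new value as far as it
  -- is determined by the entries `t < s` of the old table, the others are unchanged
  let A : ℕ → ℕ → Bool := fun s n =>
    if n < s then decide (∀ t < s, (Nat.unpair t).1 = n → T₀ t .table = false) else T₀ n .table
  let Inv : ℕ → TrackConfig ((I.State ⊕ B.State) ⊕ Option B'.State) (Track N K) → Prop :=
    fun s c => c.state = .inr (some B'.start) ∧ c.head = 0 ∧ ∃ ρ, Rep c.tape ρ ∧ ρ 0 = s ∧
      (∀ i : Fin N, c.tape 0 (.inl (some i)) = decide (i.val < k + 1)) ∧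
      ∀ n, c.tape n .table = A s n
  -- an entry that has been refuted stays `0`, and the flags are constant
  let p : ℕ → ℕ → Option (Fin N) → Bool → Prop := fun s n d v =>
    (d = none → n < s → (∃ t < s, (Nat.unpair t).1 = n ∧ T₀ t .table = true) → v = false) ∧
      ∀ i : Fin N, d = some i → n = 0 → v = decide (i.val < k + 1)
  -- because of `(unpair s).1 ≤ s`, entry `s` of the old table is still there in round `s`
  have hA : ∀ s n, A (s + 1) n = if n = (Nat.unpair s).1 ∧ T₀ s .table = true then false
      else if n = s then true else A s n := by
    intro s n
    have hle := Nat.unpair_left_le s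
    simp only [A]
    by_cases h1 : n = (Nat.unpair s).1 ∧ T₀ s .table = true
    · rw [if_pos h1, if_pos (by omega), decide_eq_false_iff_not]
      intro h
      have := h s (by omega) h1.1.symm
      rw [h1.2] at this
      cases this
    · rw [if_neg h1]
      by_cases h2 : n = s
      · subst h2
        rw [if_pos rfl, if_pos (by omega), decide_eq_true_eq]
        intro t ht htn
        rcases Nat.lt_succ_iff_lt_or_eq.1 ht with h | rfl
        · have := Nat.unpair_left_le t; omega
        · rw [← Bool.not_eq_true]; exact fun h => h1 ⟨htn.symm, h⟩
      · rw [if_neg h2]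
        by_cases h3 : n < s
        · rw [if_pos (by omega), if_pos h3, decide_eq_decide]
          constructor
          · exact fun h t ht => h t (by omega)
          · intro h t ht htn
            rcases Nat.lt_succ_iff_lt_or_eq.1 ht with h' | rfl
            · exact h t h' htn
            · rw [← Bool.not_eq_true]; exact fun h => h1 ⟨htn.symm, h⟩
        · rw [if_neg (by omega), if_neg h3]
  have hInv0 : Inv 0 ⟨.inr (some B'.start), 0, Function.update T₀ 0 (nextStage (T₀ 0))⟩ := by
    refine ⟨rfl, rfl, fun _ => 0, fun i => ⟨by simp, by simp [nextStage]⟩, rfl, ?_, ?_⟩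
    · intro i; simp [hflag']
    · intro n
      by_cases hn : n = 0
      · subst hn; simp [A, nextStage]
      · simp [A, hn]
  obtain ⟨T, hT, hT0, hT1⟩ := TrackNext.run_add_omega0 h0 hstep Inv
    (fun s => OnData (p s)) hInv0 (by
      rintro s ⟨_, _, T⟩ ⟨rfl, rfl, ρ, hTρ, h1, hf, ht⟩
      dsimp only at hTρ hf ht
      obtain ⟨b, T', ρ', hT', h1', hd', hr⟩ := hB T ρ s (p s) hTρ h1 (by
        intro n d
        refine ⟨?_, ?_⟩
        · rintro rfl hn ⟨t, hts, htn, htrue⟩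
          refine (ht n).trans ?_
          simp only [A, if_pos hn, decide_eq_false_iff_not]
          intro h
          rw [h t hts htn] at htrue
          cases htrue
        · rintro i rfl rfl
          exact hf i) ⟨fun _ h => absurd h (lt_irrefl _), by simp⟩ (fun n => ⟨by simp, by simp⟩)
      refine ⟨⟨_, 0, T'⟩, ⟨rfl, rfl, ρ', hT', h1', fun i => ?_, fun n => ?_⟩,
        hr.assemble_later⟩
      · dsimp only
        rw [hd']; simpa using hf i
      · dsimp only
        rw [hd', hA, ht n, ht s]
        simp [A])
  refine ⟨T, hT, fun n => ?_, fun i => ?_⟩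
  · constructor
    · intro h t htn htrue
      have := hT0 n .table ⟨max t n + 1, fun s hs v hv =>
        (hv none rfl).1 rfl (by omega) ⟨t, by omega, htn, htrue⟩⟩
      rw [h] at this
      cases this
    · intro h
      refine hT1 n .table fun s₀ => ⟨max s₀ (n + 1), le_max_left _ _, ?_⟩
      rintro ⟨_, _, T⟩ ⟨rfl, rfl, ρ, hTρ, h1, hf, ht⟩
      refine (ht n).trans ?_
      simp only [A, if_pos (show n < max s₀ (n + 1) by omega), decide_eq_true_eq]
      exact fun t _ htn => by simpa using h t htn
  · by_cases hi : i.val < k + 1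
    · refine (hT1 0 _ fun s₀ => ⟨s₀, le_rfl, ?_⟩).trans (by simp [hi])
      rintro ⟨_, _, T⟩ ⟨rfl, rfl, ρ, hTρ, h1, hf, ht⟩
      exact (hf i).trans (by simp [hi])
    · refine (hT0 0 _ ⟨0, fun s _ v hv => ?_⟩).trans (by simp [hi])
      exact ((hv (some i) rfl).2 i rfl rfl).trans (by simp [hi])

end Frag

/-- The decision machine: at time `ω * (N + 1)` the first square shows entry `0` of the table that
results from `hits (e x)` by `N` applications of `nor`, and shortly afterwards it halts. -/
theorem exists_ittm {e : ℕ → ℕ → ℕ} (he : Primrec₂ e) (N : ℕ) : ∃ M : ITTM, ∀ x,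
    (∃ c, M.run x (ω * ((N + 1 : ℕ) : Ordinal.{0})) = some c ∧
      (c.tape 0 = true ↔ nor^[N] (hits (e x)) 0)) ∧
    ∃ (k : ℕ) (c : M.Config), M.HaltsAt x (ω * ((N + 1 : ℕ) : Ordinal.{0}) + k) c ∧
      (c.tape 0 = true ↔ nor^[N] (hits (e x)) 0) := by
  obtain ⟨K₁, hK₁⟩ := Frag.exists_flashes he N
  obtain ⟨K₂, hK₂⟩ := Frag.exists_stepsNor N
  let K := max (max K₁ K₂) 4
  obtain ⟨B, hB⟩ := hK₁ K (by omega)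
  obtain ⟨B', hB'⟩ := hK₂ K (by omega)
  obtain ⟨w, _, enc, henc⟩ := Frag.exists_enc N K
  obtain ⟨I, hI⟩ := Frag.exists_init (show 4 ≤ K by omega) enc henc
  have := I.finiteState
  have := B.finiteState
  have := B'.finiteState
  refine ⟨(Frag.assemble I B B').toITTM enc (.inl (.inl I.start)) (.inr none), fun x => ?_⟩
  have key : ∀ k ≤ N, ∃ T, ((Frag.assemble I B B').toITTM enc (.inl (.inl I.start))
      (.inr none)).run x (ω * ((k + 1 : ℕ) : Ordinal.{0})) =
        some ((TrackConfig.mk (.inr none) 0 T).embed enc (Frag.assemble I B B')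
          (.inl (.inl I.start)) (.inr none)) ∧
      (∀ n, T n .table = true ↔ nor^[k] (hits (e x)) n) ∧
      ∀ i : Fin N, T 0 (.inl (some i)) = decide (i.val < k) := by
    intro k
    induction k with
    | zero =>
      intro _
      obtain ⟨b, T₀, ρ₀, hT₀, h1, h2, hd, hr⟩ := hI x
      obtain ⟨T, hT, ht, hf⟩ := Frag.first_stage (B' := B') hr hT₀ h1 h2 hd hB
      exact ⟨T, by simpa using hT, ht, by simpa using hf⟩
    | succ k ih =>
      intro hk
      obtain ⟨T₀, hT₀, ht₀, hf₀⟩ := ih (by omega)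
      obtain ⟨T, hT, ht, hf⟩ := Frag.later_stage hk hT₀ hf₀ hB'
      refine ⟨T, ?_, fun n => ?_, hf⟩
      · rw [← hT, Nat.cast_succ (k + 1), mul_add_one]
      · rw [ht, Function.iterate_succ_apply']
        simp only [ht₀]
  obtain ⟨T, hT, ht, hf⟩ := key N le_rfl
  have hflat : TrackNext.flat enc T 0 = T 0 .table := by
    have : enc.symm ⟨0, NeZero.pos w⟩ = .table := by
      rw [Equiv.symm_apply_eq]; exact Fin.ext henc.symm
    rw [← this]
    simpa using TrackNext.flat_add enc T 0 0 (NeZero.pos w)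
  refine ⟨⟨_, hT, ?_⟩, ?_⟩
  · rw [← ht, ← hflat]; rfl
  · -- the flags are read, and no instruction is applicable
    have hstep : (Frag.assemble I B B').step
        ⟨.inr none, 0, T⟩ = none := by
      simp [TrackNext.step, Frag.assemble, hf]
    have hreads := TrackNext.reads_all (next := Frag.assemble I B B') (enc := enc)
      (start := Sum.inl (Sum.inl I.start)) (limit := Sum.inr none) ⟨.inr none, 0, T⟩
      (C := fun _ _ => True) (fun _ => trivial)
    rw [Relation.reflTransGen_iff_eq_or_transGen] at hreads
    have hhalt := TrackNext.step_read_eq_none (enc := enc)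
      (start := Sum.inl (Sum.inl I.start)) (limit := Sum.inr none) ⟨.inr none, 0, T⟩ hstep
      (TrackNext.flat enc T) (0 * w + w)
    rcases hreads with heq | hpath
    · refine ⟨0, _, ⟨by simpa using hT, ?_⟩, by rw [← ht, ← hflat]; rfl⟩
      rw [← heq]; exact hhalt
    · obtain ⟨n, -, hn, -⟩ := ITTM.Path.run (q := fun _ _ => True) hpath hT
      exact ⟨n, _, ⟨hn, hhalt⟩, by rw [← ht, ← hflat]⟩

/-! ### The arithmetical hierarchy -/

namespace ArithLevel

theorem comp {k l : ℕ} {b : Bool} {n : ℕ} {R : List.Vector ℕ k → Prop} (h : ArithLevel b n R)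
    {f : List.Vector ℕ l → List.Vector ℕ k} (hf : Computable f) :
    ArithLevel b n fun v => R (f v) := by
  induction n generalizing b k l with
  | zero =>
    simp only [ArithLevel, ComputablePred.computable_iff] at h ⊢
    obtain ⟨g, hg, rfl⟩ := h
    exact ⟨_, hg.comp hf, rfl⟩
  | succ n ih =>
    have hf' : Computable fun w : List.Vector ℕ (l + 1) => w.head ::ᵥ f w.tail :=
      Computable.vector_cons.comp Computable.vector_head (hf.comp Computable.vector_tail)
    cases b <;>
    · simp only [ArithLevel] at h ⊢
      obtain ⟨S, hS, hR⟩ := h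
      exact ⟨_, ih hS hf', fun v => by simp [hR]⟩

theorem not {k : ℕ} {b : Bool} {n : ℕ} {R : List.Vector ℕ k → Prop} (h : ArithLevel b n R) :
    ArithLevel (!b) n fun v => ¬ R v := by
  induction n generalizing b k with
  | zero =>
    simp only [ArithLevel] at h ⊢
    exact h.not
  | succ n ih =>
    cases b <;>
    · simp only [ArithLevel, Bool.not_true, Bool.not_false] at h ⊢
      obtain ⟨S, hS, hR⟩ := h
      exact ⟨_, ih hS, fun v => by simp [hR]⟩

/-- Adding a vacuous quantifier in front. -/
theorem succ_not {k : ℕ} {b : Bool} {n : ℕ} {R : List.Vector ℕ k → Prop} (h : ArithLevel b n R) :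
    ArithLevel (!b) (n + 1) R := by
  cases b <;> exact ⟨_, h.comp Computable.vector_tail, fun v => by simp⟩

/-- Adding a vacuous quantifier behind all others. -/
theorem succ {k : ℕ} {b : Bool} {n : ℕ} {R : List.Vector ℕ k → Prop} (h : ArithLevel b n R) :
    ArithLevel b (n + 1) R := by
  induction n generalizing b k with
  | zero =>
    have h' : ArithLevel (!b) 0 R := h
    simpa using h'.succ_not
  | succ n ih =>
    cases b <;>
    · obtain ⟨S, hS, hR⟩ := h
      exact ⟨S, ih hS, hR⟩

theorem mono {k : ℕ} {b : Bool} {n m : ℕ} (hnm : n ≤ m) {R : List.Vector ℕ k → Prop}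
    (h : ArithLevel b n R) : ArithLevel b m R := by
  induction hnm with
  | refl => exact h
  | step _ ih => exact ih.succ

theorem and {k : ℕ} {b : Bool} {n : ℕ} {R R' : List.Vector ℕ k → Prop} (h : ArithLevel b n R)
    (h' : ArithLevel b n R') : ArithLevel b n fun v => R v ∧ R' v := by
  induction n generalizing b k with
  | zero =>
    simp only [ArithLevel, ComputablePred.computable_iff] at h h' ⊢
    obtain ⟨g, hg, rfl⟩ := h
    obtain ⟨g', hg', rfl⟩ := h'
    exact ⟨_, Primrec.and.to_comp.comp hg hg', by simp⟩
  | succ n ih =>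
    cases b with
    | false =>
      obtain ⟨S, hS, hR⟩ := h
      obtain ⟨S', hS', hR'⟩ := h'
      exact ⟨_, ih hS hS', fun v => by simp [hR, hR', forall_and]⟩
    | true =>
      -- the two witnesses are combined to a pair
      obtain ⟨S, hS, hR⟩ := h
      obtain ⟨S', hS', hR'⟩ := h'
      have hc1 : Computable fun w : List.Vector ℕ (k + 1) => (Nat.unpair w.head).1 ::ᵥ w.tail :=
        Computable.vector_cons.comp
          ((Computable.fst.comp Computable.unpair).comp Computable.vector_head)
          Computable.vector_tail
      have hc2 : Computable fun w : List.Vector ℕ (k + 1) => (Nat.unpair w.head).2 ::ᵥ w.tail :=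
        Computable.vector_cons.comp
          ((Computable.snd.comp Computable.unpair).comp Computable.vector_head)
          Computable.vector_tail
      refine ⟨_, ih (hS.comp hc1) (hS'.comp hc2), fun v => ?_⟩
      simp only [hR, hR', List.Vector.head_cons, List.Vector.tail_cons]
      constructor
      · rintro ⟨⟨y, hy⟩, z, hz⟩
        exact ⟨Nat.pair y z, by simpa using hy, by simpa using hz⟩
      · rintro ⟨y, h1, h2⟩
        exact ⟨⟨_, h1⟩, _, h2⟩

end ArithLevel

/-! ### Normal forms -/

/-- The search, for all `y' ≤ y` in turn, for a number `z` with `f ⟨z, y', a⟩`. -/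
def searchAll {α : Type} (f : ℕ × ℕ × α → Bool) (a : α) (y : ℕ) : Part ℕ :=
  Nat.rec (Part.some 0)
    (fun y' (r : Part ℕ) => r.bind fun _ => Nat.rfind fun z => Part.some (f (z, y', a))) (y + 1)

theorem searchAll_dom {α : Type} (f : ℕ × ℕ × α → Bool) (a : α) (y : ℕ) :
    (searchAll f a y).Dom ↔ ∀ y' ≤ y, ∃ z, f (z, y', a) = true := by
  have key : ∀ n, (Nat.rec (motive := fun _ => Part ℕ) (Part.some 0)
      (fun y' r => r.bind fun _ => Nat.rfind fun z => Part.some (f (z, y', a))) n).Dom ↔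
      ∀ y' < n, ∃ z, f (z, y', a) = true := by
    intro n
    induction n with
    | zero => simp
    | succ n ih =>
      simp only [Part.bind_dom]
      constructor
      · rintro ⟨h1, h2⟩ y' hy'
        rcases Nat.lt_succ_iff_lt_or_eq.1 hy' with h | rfl
        · exact ih.1 h1 y' h
        · obtain ⟨z, hz, -⟩ := Nat.rfind_dom.1 h2
          exact ⟨z, (Part.mem_some_iff.1 hz).symm⟩
      · intro h
        refine ⟨ih.2 fun y' hy' => h y' (by omega), Nat.rfind_dom.2 ?_⟩
        obtain ⟨z, hz⟩ := h n (by omega)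
        exact ⟨z, by simp [hz], fun _ => trivial⟩
  simpa [searchAll, Nat.lt_succ_iff] using key (y + 1)

theorem searchAll_partrec {α β : Type} [Primcodable α] [Primcodable β] {f : ℕ × ℕ × α → Bool}
    (hf : Computable f) {a : β → α} (ha : Computable a) {y : β → ℕ} (hy : Computable y) :
    Partrec fun b => searchAll f (a b) (y b) := by
  refine Partrec.nat_rec (f := fun b => y b + 1) (g := fun _ => Part.some 0)
    (h := fun b p => Nat.rfind fun z => Part.some (f (z, p.1, a b)))
    (Computable.succ.comp hy) (Computable.const 0).partrec (Partrec.rfind ?_)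
  refine Computable.partrec (f := fun q : (β × ℕ × ℕ) × ℕ => f (q.2, q.1.2.1, a q.1.1)) ?_
  exact hf.comp (Computable.pair Computable.snd (Computable.pair
    (Computable.fst.comp (Computable.snd.comp Computable.fst))
    (ha.comp (Computable.fst.comp Computable.fst))))

open Nat.Partrec (Code) in
/-- The `Π₂` relations are those of being an infinitely often taken value of a primitive recursive
sequence: `m` is taken once for each `y` such that a `z` is found for all `y' ≤ y`, namely at the
index `s = ⟨m, y, k⟩` where `k` is the time at which the search succeeds; the sequence takes the
value `s` at the other indices `s`. -/
theorem exists_hits {R : List.Vector ℕ 2 → Prop} (hR : ArithLevel false 2 R) :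
    ∃ e : ℕ → ℕ → ℕ, Primrec₂ e ∧
      ∀ x m, R (x ::ᵥ m ::ᵥ List.Vector.nil) ↔ hits (e x) m := by
  simp only [ArithLevel, ComputablePred.computable_iff] at hR
  obtain ⟨S, ⟨S', ⟨g, hg, rfl⟩, hS⟩, hR⟩ := hR
  let f : ℕ × ℕ × ℕ × ℕ → Bool := fun q =>
    g (q.1 ::ᵥ q.2.1 ::ᵥ q.2.2.1 ::ᵥ q.2.2.2 ::ᵥ List.Vector.nil)
  have hf : Computable f := by
    have h1 : Computable fun q : ℕ × ℕ × ℕ × ℕ => q.2.1 := Computable.fst.comp Computable.snd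
    have h2 : Computable fun q : ℕ × ℕ × ℕ × ℕ => q.2.2 := Computable.snd.comp Computable.snd
    exact hg.comp (Computable.vector_cons.comp Computable.fst (Computable.vector_cons.comp h1
      (Computable.vector_cons.comp (Computable.fst.comp h2) (Computable.vector_cons.comp
        (Computable.snd.comp h2) (Computable.const _)))))
  have hRf : ∀ x m, R (x ::ᵥ m ::ᵥ List.Vector.nil) ↔ ∀ y, ∃ z, f (z, y, x, m) = true :=
    fun x m => by simp [hR, hS, f]
  have hfst : Primrec fun s => (Nat.unpair s).1 := Primrec.fst.comp Primrec.unpair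
  have hsnd : Primrec fun s => (Nat.unpair s).2 := Primrec.snd.comp Primrec.unpair
  obtain ⟨c, hc⟩ := Code.exists_code.1 (Partrec.nat_iff.1 (searchAll_partrec hf
    (a := fun b => ((Nat.unpair b).1, (Nat.unpair (Nat.unpair b).2).1))
    (Computable.pair hfst.to_comp (hfst.comp hsnd).to_comp)
    (y := fun b => (Nat.unpair (Nat.unpair b).2).2) (hsnd.comp hsnd).to_comp))
  -- `found x m y k`: the search has succeeded at time `k`
  let found : ℕ → ℕ → ℕ → ℕ → Bool := fun x m y k =>
    (Code.evaln k c (Nat.pair x (Nat.pair m y))).isSome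
  have hfound : ∀ x m y, (∃ k, found x m y k = true) ↔ ∀ y' ≤ y, ∃ z, f (z, y', x, m) = true := by
    intro x m y
    rw [← searchAll_dom]
    have : searchAll f (x, m) y = c.eval (Nat.pair x (Nat.pair m y)) := by rw [hc]; simp
    rw [this, Part.dom_iff_mem]
    simp only [Code.evaln_complete, found, Option.isSome_iff_exists]
    exact exists_comm
  have hmono : ∀ x m y {k l}, k ≤ l → found x m y k = true → found x m y l = true := by
    intro x m y k l hkl h
    obtain ⟨v, hv⟩ := Option.isSome_iff_exists.1 h
    exact Option.isSome_iff_exists.2 ⟨v, Code.evaln_mono hkl hv⟩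
  let e : ℕ → ℕ → ℕ := fun x s =>
    bif found x (Nat.unpair s).1 (Nat.unpair (Nat.unpair s).2).1
        ((Nat.unpair (Nat.unpair s).2).2 + 1) &&
      !found x (Nat.unpair s).1 (Nat.unpair (Nat.unpair s).2).1 (Nat.unpair (Nat.unpair s).2).2
    then (Nat.unpair s).1 else s
  refine ⟨e, ?_, fun x m => ?_⟩
  · have hprim : ∀ {t : ℕ × ℕ → ℕ}, Primrec t → Primrec fun p : ℕ × ℕ =>
        found p.1 (Nat.unpair p.2).1 (Nat.unpair (Nat.unpair p.2).2).1 (t p) := by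
      intro t ht
      have h1 : Primrec fun p : ℕ × ℕ => Nat.pair p.1 (Nat.pair (Nat.unpair p.2).1
          (Nat.unpair (Nat.unpair p.2).2).1) :=
        Primrec₂.natPair.comp Primrec.fst (Primrec₂.natPair.comp (hfst.comp Primrec.snd)
          ((hfst.comp hsnd).comp Primrec.snd))
      exact Primrec.option_isSome.comp (Code.primrec_evaln.comp
        (Primrec.pair (Primrec.pair ht (Primrec.const c)) h1))
    have hk : Primrec fun p : ℕ × ℕ => (Nat.unpair (Nat.unpair p.2).2).2 :=
      (hsnd.comp hsnd).comp Primrec.snd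
    exact Primrec.cond (Primrec.and.comp (hprim (Primrec.succ.comp hk))
      (Primrec.not.comp (hprim hk))) (hfst.comp Primrec.snd) Primrec.snd
  · rw [hRf]
    constructor
    · intro h s₀
      have hex := (hfound x m s₀).2 fun y' _ => h y'
      classical
      have hspec := Nat.find_spec hex
      have hmin : ∀ {k}, k < Nat.find hex → ¬ found x m s₀ k = true := Nat.find_min hex
      generalize Nat.find hex = k at hspec hmin
      obtain ⟨k, rfl⟩ : ∃ l, k = l + 1 := by
        refine Nat.exists_eq_succ_of_ne_zero ?_
        rintro rfl
        simp [found, Code.evaln] at hspec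
      refine ⟨Nat.pair m (Nat.pair s₀ k), (Nat.left_le_pair _ _).trans (Nat.right_le_pair _ _), ?_⟩
      simp [e, hspec, hmin (Nat.lt_succ_self k)]
    · intro h
      by_contra hn
      push Not at hn
      obtain ⟨y₀, hy₀⟩ := hn
      -- for each `y` the search succeeds for the first time at most once, and never if `y₀ ≤ y`;
      -- so the value `m` is taken finitely often
      have huniq : ∀ y, ∃ K, ∀ k, found x m y (k + 1) = true → ¬ found x m y k = true → k = K := by
        intro y
        by_cases hk : ∃ k, found x m y (k + 1) = true ∧ ¬ found x m y k = true
        · obtain ⟨K, hK1, hK2⟩ := hk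
          refine ⟨K, fun k h1 h2 => ?_⟩
          by_contra hne
          rcases lt_or_gt_of_ne hne with h' | h'
          · exact hK2 (hmono _ _ _ h' h1)
          · exact h2 (hmono _ _ _ h' hK1)
        · exact ⟨0, fun k h1 h2 => absurd ⟨k, h1, h2⟩ hk⟩
      choose K hK using huniq
      have hfin : {s | e x s = m} ⊆ ↑(insert m ((Finset.range y₀).image fun y =>
          Nat.pair m (Nat.pair y (K y)))) := by
        intro s hs
        simp only [Set.mem_ofPred_eq, e, cond_eq_ite, Bool.and_eq_true, Bool.not_eq_true'] at hs
        simp only [Finset.coe_insert, Finset.coe_image, Set.mem_insert_iff, Set.mem_image,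
          Finset.coe_range, Set.mem_Iio]
        split_ifs at hs with hif
        · right
          rw [hs] at hif
          refine ⟨(Nat.unpair (Nat.unpair s).2).1, ?_, ?_⟩
          · by_contra hlt
            obtain ⟨z, hz⟩ := (hfound x m _).1 ⟨_, hif.1⟩ y₀ (not_lt.1 hlt)
            exact hy₀ z hz
          · rw [← hK _ _ hif.1 (by simp [hif.2]), Nat.pair_unpair]
            conv_rhs => rw [← Nat.pair_unpair s, hs]
        · exact .inl hs
      obtain ⟨s₀, hs₀⟩ := ((Finset.finite_toSet _).subset hfin).bddAbove
      obtain ⟨s, hs, hs'⟩ := h (s₀ + 1)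
      have := hs₀ hs'
      omega

/-- The `Πₙ₊₂` relations arise from infinitely often taken values by `n` applications of `nor`. -/
theorem exists_nor_hits (n : ℕ) {R : List.Vector ℕ 2 → Prop} (hR : ArithLevel false (n + 2) R) :
    ∃ e : ℕ → ℕ → ℕ, Primrec₂ e ∧
      ∀ x m, R (x ::ᵥ m ::ᵥ List.Vector.nil) ↔ nor^[n] (hits (e x)) m := by
  induction n generalizing R with
  | zero => exact exists_hits hR
  | succ n ih =>
    obtain ⟨S, hS, hR⟩ := hR
    -- `R(x, m) ↔ ∀ y, S(y, x, m)` is `nor` of the relation `¬ S(y, x, m)` of `x` and `⟨m, y⟩`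
    have hc : Computable fun v : List.Vector ℕ 2 =>
        (Nat.unpair v.tail.head).2 ::ᵥ v.head ::ᵥ (Nat.unpair v.tail.head).1 ::ᵥ
          (List.Vector.nil : List.Vector ℕ 0) := by
      have ht : Computable fun v : List.Vector ℕ 2 => Nat.unpair v.tail.head :=
        Computable.unpair.comp (Computable.vector_head.comp Computable.vector_tail)
      exact Computable.vector_cons.comp (Computable.snd.comp ht) (Computable.vector_cons.comp
        Computable.vector_head (Computable.vector_cons.comp (Computable.fst.comp ht)
          (Computable.const _)))
    obtain ⟨e, he, heS⟩ := ih (R := fun v => ¬ S ((Nat.unpair v.tail.head).2 ::ᵥ v.head ::ᵥ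
      (Nat.unpair v.tail.head).1 ::ᵥ List.Vector.nil)) (hS.comp hc).not
    refine ⟨e, he, fun x m => ?_⟩
    rw [hR, Function.iterate_succ_apply', nor]
    simp only [← heS, List.Vector.head_cons, List.Vector.tail_cons, not_not]
    constructor
    · rintro h t rfl
      exact h _
    · intro h y
      have := h (Nat.pair m y)
      simpa using this

/-- Every `Πₙ₊₂` predicate is decided in `ω * (n + 1)` steps, and by a halting machine before
time `ω * (n + 2)`. -/
theorem InPi.decides {n : ℕ} {P : ℕ → Prop} (hP : InPi (n + 2) P) : ∃ M : ITTM,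
    M.DecidesIn (ω * ((n + 1 : ℕ) : Ordinal.{0})) P ∧
      M.DecidesHaltingWithin (ω * ((n + 2 : ℕ) : Ordinal.{0})) P := by
  have hc : Computable fun v : List.Vector ℕ 2 => v.head ::ᵥ (List.Vector.nil : List.Vector ℕ 0) :=
    Computable.vector_cons.comp Computable.vector_head (Computable.const _)
  obtain ⟨e, he, heP⟩ := exists_nor_hits n (ArithLevel.comp hP hc)
  simp only [List.Vector.head_cons] at heP
  obtain ⟨M, hM⟩ := exists_ittm he n
  refine ⟨M, fun x => ?_, fun x => ?_⟩
  · obtain ⟨⟨c, hc, hc'⟩, -⟩ := hM x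
    exact ⟨c, .inl hc, hc'.trans (heP x 0).symm⟩
  · obtain ⟨-, k, c, hc, hc'⟩ := hM x
    refine ⟨_, ?_, c, hc, hc'.trans (heP x 0).symm⟩
    rw [Nat.cast_succ (n + 1), mul_add_one]
    gcongr
    exact (Ordinal.natCast_lt_omega0 k).le

theorem omega0_mul_natCast_lt (n : ℕ) : ω * (n : Ordinal.{0}) < ω ^ 2 := by
  rw [pow_two]
  gcongr
  · exact Ordinal.omega0_pos
  · exact Ordinal.natCast_lt_omega0 n

theorem InDelta.decides {n : ℕ} (hn : 1 ≤ n) {P : ℕ → Prop} (hP : InDelta (n + 1) P) :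
    ∃ M : ITTM, M.DecidesIn (ω * (n : Ordinal.{0})) P := by
  obtain ⟨n, rfl⟩ := Nat.exists_eq_succ_of_ne_zero (by omega : n ≠ 0)
  obtain ⟨M, hM, -⟩ := InPi.decides hP.2
  exact ⟨M, hM⟩

theorem IsArithmetical.exists_inDelta {P : ℕ → Prop} (hP : IsArithmetical P) :
    ∃ n, 1 ≤ n ∧ InDelta (n + 1) P := by
  obtain ⟨n, hn | hn⟩ := hP
  · exact ⟨n + 1, by omega, ArithLevel.succ (ArithLevel.succ hn),
      ArithLevel.succ (ArithLevel.succ_not hn)⟩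
  · exact ⟨n + 1, by omega, ArithLevel.succ (ArithLevel.succ_not hn),
      ArithLevel.succ (ArithLevel.succ hn)⟩

theorem IsArithmetical.decides {P : ℕ → Prop} (hP : IsArithmetical P) :
    ∃ M : ITTM, ∃ t < (ω : Ordinal.{0}) ^ 2, M.DecidesHaltingWithin t P := by
  obtain ⟨n, hn, hP⟩ := hP.exists_inDelta
  obtain ⟨n, rfl⟩ := Nat.exists_eq_succ_of_ne_zero (by omega : n ≠ 0)
  obtain ⟨M, -, hM⟩ := InPi.decides hP.2
  exact ⟨M, _, omega0_mul_natCast_lt _, hM⟩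

/-! ### Formulae of arithmetic -/

/-- The relation `R` is arithmetical. -/
def IsArithRel {k : ℕ} (R : List.Vector ℕ k → Prop) : Prop := ∃ n, ArithLevel false n R

namespace IsArithRel

variable {k : ℕ} {R R' : List.Vector ℕ k → Prop}

theorem of_iff (h : IsArithRel R) (hR : ∀ v, R' v ↔ R v) : IsArithRel R' := by
  obtain rfl : R' = R := funext fun v => propext (hR v)
  exact h

theorem not (h : IsArithRel R) : IsArithRel fun v => ¬ R v := by
  obtain ⟨n, hn⟩ := h
  exact ⟨n + 1, hn.not.succ_not⟩

theorem and (h : IsArithRel R) (h' : IsArithRel R') : IsArithRel fun v => R v ∧ R' v := by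
  obtain ⟨n, hn⟩ := h
  obtain ⟨m, hm⟩ := h'
  exact ⟨max n m, (hn.mono (le_max_left _ _)).and (hm.mono (le_max_right _ _))⟩

theorem forall_nat {R : List.Vector ℕ (k + 1) → Prop} (h : IsArithRel R) :
    IsArithRel fun v => ∀ y, R (y ::ᵥ v) := by
  obtain ⟨n, hn⟩ := h
  exact ⟨n + 2, R, hn.succ_not, fun _ => Iff.rfl⟩

theorem comp {l : ℕ} (h : IsArithRel R) {f : List.Vector ℕ l → List.Vector ℕ k}
    (hf : Computable f) : IsArithRel fun v => R (f v) := by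
  obtain ⟨n, hn⟩ := h
  exact ⟨n, hn.comp hf⟩

end IsArithRel

/-- The assignment that maps the variables below `k` to the entries of a vector. -/
def assign {k : ℕ} (v : List.Vector ℕ k) (i : ℕ) : ℕ := if h : i < k then v.get ⟨i, h⟩ else 0

theorem ArithTerm.computable_eval {k : ℕ} (t : ArithTerm) :
    Computable fun v : List.Vector ℕ k => t.eval (assign v) := by
  induction t with
  | num n => exact Computable.const n
  | var i =>
    by_cases h : i < k
    · simpa [ArithTerm.eval, assign, h] using
        Computable.vector_get.comp Computable.id (Computable.const (⟨i, h⟩ : Fin k))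
    · simpa [ArithTerm.eval, assign, h] using Computable.const 0
  | add s t hs ht => exact Primrec.nat_add.to_comp.comp hs ht
  | mul s t hs ht => exact Primrec.nat_mul.to_comp.comp hs ht

theorem ArithTerm.eval_congr {t : ArithTerm} {e e' : ℕ → ℕ} (h : ∀ i ∈ t.vars, e i = e' i) :
    t.eval e = t.eval e' := by
  induction t with
  | num n => rfl
  | var i => exact h i (by simp [ArithTerm.vars])
  | add s t hs ht | mul s t hs ht =>
    simp only [ArithTerm.eval]
    rw [hs fun i hi => h i (by simp [ArithTerm.vars, hi]),
      ht fun i hi => h i (by simp [ArithTerm.vars, hi])]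

namespace ArithFormula

theorem holds_congr {f : ArithFormula} {e e' : ℕ → ℕ} (h : ∀ i ∈ f.freeVars, e i = e' i) :
    f.Holds e ↔ f.Holds e' := by
  induction f generalizing e e' with
  | eq s t =>
    simp only [Holds]
    rw [ArithTerm.eval_congr fun i hi => h i (by simp [freeVars, hi]),
      ArithTerm.eval_congr fun i hi => h i (by simp [freeVars, hi])]
  | not f hf => exact not_congr (hf h)
  | and f g hf hg =>
    exact and_congr (hf fun i hi => h i (by simp [freeVars, hi]))
      (hg fun i hi => h i (by simp [freeVars, hi]))
  | or f g hf hg =>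
    exact or_congr (hf fun i hi => h i (by simp [freeVars, hi]))
      (hg fun i hi => h i (by simp [freeVars, hi]))
  | imp f g hf hg =>
    exact imp_congr (hf fun i hi => h i (by simp [freeVars, hi]))
      (hg fun i hi => h i (by simp [freeVars, hi]))
  | all j f hf =>
    refine forall_congr' fun a => hf fun i hi => ?_
    by_cases hij : i = j
    · subst hij; simp
    · simpa [hij] using h i (by simp [freeVars, hi, hij])
  | ex j f hf =>
    refine exists_congr fun a => hf fun i hi => ?_
    by_cases hij : i = j
    · subst hij; simp
    · simpa [hij] using h i (by simp [freeVars, hi, hij])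

theorem freeVars_subset_allVars (f : ArithFormula) : f.freeVars ⊆ f.allVars := by
  induction f with
  | eq s t => exact subset_rfl
  | not f hf => exact hf
  | and f g hf hg | or f g hf hg | imp f g hf hg => exact Finset.union_subset_union hf hg
  | all i f hf | ex i f hf =>
    exact (Finset.erase_subset _ _).trans (hf.trans (Finset.subset_insert _ _))

/-- A quantified variable of the formula, which is a coordinate of the vector, is replaced by a new
first coordinate, over which the quantifier of `IsArithRel.forall_nat` ranges. -/
theorem isArithRel_forall {k : ℕ} {f : ArithFormula}
    (hf : IsArithRel fun v : List.Vector ℕ k => f.Holds (assign v)) {i : ℕ} (hi : i < k) :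
    IsArithRel fun v : List.Vector ℕ k => ∀ a, f.Holds (Function.update (assign v) i a) := by
  have hc : Computable fun w : List.Vector ℕ (k + 1) =>
      List.Vector.ofFn fun j : Fin k => if j = ⟨i, hi⟩ then w.head else w.tail.get j := by
    refine Computable.vector_ofFn fun j => ?_
    by_cases h : j = ⟨i, hi⟩
    · simpa [h] using Computable.vector_head
    · have : Computable fun w : List.Vector ℕ (k + 1) => w.tail.get j :=
        Computable.vector_get.comp Computable.vector_tail (Computable.const j)
      simpa [h] using this
  refine (hf.comp hc).forall_nat.of_iff fun v => forall_congr' fun a => ?_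
  have : Function.update (assign v) i a = assign (List.Vector.ofFn fun j : Fin k =>
      if j = ⟨i, hi⟩ then (a ::ᵥ v).head else (a ::ᵥ v).tail.get j) := by
    funext j
    by_cases hj : j = i
    · subst hj; simp [assign, hi]
    · by_cases hjk : j < k <;> simp [assign, hj, hjk]
  rw [this]

theorem isArithRel_holds {k : ℕ} (f : ArithFormula) (hf : ∀ i ∈ f.allVars, i < k) :
    IsArithRel fun v : List.Vector ℕ k => f.Holds (assign v) := by
  induction f with
  | eq s t =>
    refine ⟨0, ComputablePred.computable_iff.2 ⟨_,
      Primrec.beq.to_comp.comp s.computable_eval t.computable_eval, ?_⟩⟩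
    funext v
    simp [Holds]
  | not f ihf => exact (ihf hf).not
  | and f g ihf ihg =>
    exact (ihf fun i hi => hf i (by simp [allVars, hi])).and
      (ihg fun i hi => hf i (by simp [allVars, hi]))
  | or f g ihf ihg =>
    refine ((ihf fun i hi => hf i (by simp [allVars, hi])).not.and
      (ihg fun i hi => hf i (by simp [allVars, hi])).not).not.of_iff fun v => ?_
    simp only [Holds]; tauto
  | imp f g ihf ihg =>
    refine ((ihf fun i hi => hf i (by simp [allVars, hi])).and
      (ihg fun i hi => hf i (by simp [allVars, hi])).not).not.of_iff fun v => ?_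
    simp only [Holds]; tauto
  | all i f ihf =>
    exact isArithRel_forall (ihf fun i hi => hf i (by simp [allVars, hi]))
      (hf i (by simp [allVars]))
  | ex i f ihf =>
    refine (isArithRel_forall (f := .not f) (ihf fun i hi => hf i (by simp [allVars, hi])).not
      (hf i (by simp [allVars]))).not.of_iff fun v => ?_
    simp [Holds]

theorem isArithmetical_pred {f : ArithFormula} {x : ℕ} (hx : f.freeVars = {x}) :
    IsArithmetical (f.Pred x) := by
  obtain ⟨k, hk⟩ : ∃ k, ∀ i ∈ f.allVars, i < k :=
    ⟨f.allVars.sup id + 1, fun i hi => Nat.lt_succ_of_le (Finset.le_sup (f := id) hi)⟩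
  have hxk : x < k := hk x (f.freeVars_subset_allVars (by simp [hx]))
  have hc : Computable fun w : List.Vector ℕ 1 =>
      List.Vector.ofFn fun j : Fin k => if j = ⟨x, hxk⟩ then w.head else 0 := by
    refine Computable.vector_ofFn fun j => ?_
    by_cases h : j = ⟨x, hxk⟩
    · simpa [h] using Computable.vector_head
    · simpa [h] using Computable.const 0
  obtain ⟨n, hn⟩ := ((f.isArithRel_holds hk).comp hc).of_iff
    (R' := fun v : List.Vector ℕ 1 => f.Pred x v.head) fun v => by
    have hval : assign (List.Vector.ofFn fun j : Fin k => if j = ⟨x, hxk⟩ then v.head else 0) x =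
        v.head := by simp [assign, hxk]
    refine ⟨fun h => h _ hval, fun h e he => (holds_congr fun i hi => ?_).1 h⟩
    rw [hx, Finset.mem_singleton] at hi
    subst hi
    rw [hval, he]
  exact ⟨n, .inr hn⟩

/-! ### Adding a new variable to an equation -/

theorem exists_addsVar (x : ℕ) (f : ArithFormula) : ∃ g, AddsVar x f g := by
  induction f with
  | eq s t => exact ⟨_, .eqLeft s t⟩
  | not f hf => exact hf.imp' _ fun _ => .not
  | and f g hf _ => exact hf.imp' _ fun _ => .andLeft g
  | or f g hf _ => exact hf.imp' _ fun _ => .orLeft g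
  | imp f g hf _ => exact hf.imp' _ fun _ => .impLeft g
  | all i f hf => exact hf.imp' _ fun _ => .all i
  | ex i f hf => exact hf.imp' _ fun _ => .ex i

theorem AddsVar.freeVars_eq {x : ℕ} {f g : ArithFormula} (h : AddsVar x f g)
    (hx : x ∉ f.allVars) : g.freeVars = insert x f.freeVars := by
  induction h with
  | eqLeft s t | eqRight s t => ext i; simp [freeVars, ArithTerm.vars]
  | not _ ih => exact ih hx
  | andLeft h _ ih | orLeft h _ ih | impLeft h _ ih =>
    simp only [freeVars]
    rw [ih fun h => hx (by simp [allVars, h]), Finset.insert_union]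
  | andRight h _ ih | orRight h _ ih | impRight h _ ih =>
    simp only [freeVars]
    rw [ih fun h => hx (by simp [allVars, h]), Finset.union_insert]
  | all i _ ih | ex i _ ih =>
    simp only [allVars, Finset.mem_insert, not_or] at hx
    simp only [freeVars]
    rw [ih hx.2, Finset.erase_insert_of_ne hx.1]

theorem AddsVar.holds_iff {x : ℕ} {f g : ArithFormula} (h : AddsVar x f g)
    (hx : x ∉ f.allVars) {e : ℕ → ℕ} (he : e x = 0) : g.Holds e ↔ f.Holds e := by
  induction h generalizing e with
  | eqLeft s t | eqRight s t => simp [Holds, ArithTerm.eval, he]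
  | not _ ih => exact not_congr (ih hx he)
  | andLeft h _ ih => exact and_congr_left' (ih (fun h => hx (by simp [allVars, h])) he)
  | andRight h _ ih => exact and_congr_right' (ih (fun h => hx (by simp [allVars, h])) he)
  | orLeft h _ ih => exact or_congr_left (ih (fun h => hx (by simp [allVars, h])) he)
  | orRight h _ ih => exact or_congr_right (ih (fun h => hx (by simp [allVars, h])) he)
  | impLeft h _ ih => exact imp_congr_left (ih (fun h => hx (by simp [allVars, h])) he)
  | impRight h _ ih =>
    exact imp_congr_right fun _ => ih (fun h => hx (by simp [allVars, h])) he
  | all i _ ih =>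
    simp only [allVars, Finset.mem_insert, not_or] at hx
    exact forall_congr' fun a => ih hx.2 (by simp [hx.1, he])
  | ex i _ ih =>
    simp only [allVars, Finset.mem_insert, not_or] at hx
    exact exists_congr fun a => ih hx.2 (by simp [hx.1, he])

theorem AddsVar.pred_zero_iff {x : ℕ} {f g : ArithFormula} (h : AddsVar x f g)
    (hf : f.IsSentence) (hx : x ∉ f.allVars) : g.Pred x 0 ↔ f.IsTrue := by
  constructor
  · intro hg e
    have h0 : Function.update e x 0 x = 0 := Function.update_self x 0 e
    refine (holds_congr (e := Function.update e x 0) fun i hi => ?_).1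
      ((h.holds_iff hx h0).1 (hg _ h0))
    rw [hf] at hi
    simp at hi
  · exact fun hf e he => (h.holds_iff hx he).2 (hf e)

end ArithFormula

theorem mainTheorem1 :
    -- for `n ≥ 1`, every predicate in `Δₙ₊₁` is decided in `ω · n` steps
    (∀ n : ℕ, 1 ≤ n → ∀ P : ℕ → Prop, InDelta (n + 1) P →
      ∃ M : ITTM, M.DecidesIn (ω * (n : Ordinal.{0})) P) ∧
    -- every arithmetical predicate is in some `Δₙ₊₁`, and is decided by a machine that halts on
    -- every input, in fewer than `ω²` steps
    (∀ P : ℕ → Prop, IsArithmetical P →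
      (∃ n : ℕ, 1 ≤ n ∧ InDelta (n + 1) P ∧
        ∃ M : ITTM, M.DecidesIn (ω * (n : Ordinal.{0})) P) ∧
      ∃ M : ITTM, ∃ t < (ω : Ordinal.{0}) ^ 2, M.DecidesHaltingWithin t P) ∧
    -- in particular, every predicate expressed by a formula of arithmetic with one free variable
    (∀ (f : ArithFormula) (x : ℕ), f.freeVars = {x} →
      ∃ M : ITTM, ∃ t < (ω : Ordinal.{0}) ^ 2, M.DecidesHaltingWithin t (f.Pred x)) ∧
    -- every sentence contains an equation to one side of which a new variable can be added;
    -- however this is done, the new formula expresses a predicate that is decided in fewer than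
    -- `ω²` steps by a machine whose answer on input `0` is the truth value of the sentence
    (∀ f : ArithFormula, f.IsSentence → ∀ x : ℕ, x ∉ f.allVars →
      (∃ g : ArithFormula, ArithFormula.AddsVar x f g) ∧
      ∀ g : ArithFormula, ArithFormula.AddsVar x f g →
        g.freeVars = {x} ∧ (g.Pred x 0 ↔ f.IsTrue) ∧
        ∃ M : ITTM, ∃ t < (ω : Ordinal.{0}) ^ 2, M.DecidesHaltingWithin t (g.Pred x) ∧
          ∃ s ≤ t, ∃ c, M.HaltsAt 0 s c ∧ (c.tape 0 = true ↔ f.IsTrue)) := by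
  refine ⟨fun n hn P hP => hP.decides hn, fun P hP => ⟨?_, hP.decides⟩,
    fun f x hx => (f.isArithmetical_pred hx).decides,
    fun f hf x hx => ⟨f.exists_addsVar x, fun g hg => ?_⟩⟩
  · obtain ⟨n, hn, hP⟩ := hP.exists_inDelta
    exact ⟨n, hn, hP, hP.decides hn⟩
  · have hfree : g.freeVars = {x} := by
      rw [hg.freeVars_eq hx, hf]; rfl
    have hiff := hg.pred_zero_iff hf hx
    obtain ⟨M, t, ht, hM⟩ := (g.isArithmetical_pred hfree).decides
    obtain ⟨s, hs, c, hc, hc'⟩ := hM 0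
    exact ⟨hfree, hiff, M, t, ht, hM, s, hs, c, hc, hc'.trans hiff⟩
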